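/- Let $\omega$ be a finite signed Borel (i.e. bounded Radon) measure on $\mathbb{R}^2$ that belongs to $H^{-1}_{\mathrm{loc}}(\mathbb{R}^2)$, with variation $|\omega|$ and norm $\|\omega\|_{\mathcal M}=|\omega|(\mathbb{R}^2)$. Let $u=K*\omega$ almost everywhere, that is, $u(x)=\int_{\mathbb{R}^2}K(x-y)\,d\omega(y)$ for a.e. $x$, where $K(x)=\frac{1}{2\pi}\frac{x^\perp}{|x|^2}$ and $x^\perp=(-x_2,x_1)$. For $r>0$ put $$M_r(\omega)=\sup_{x\in\mathbb{R}^2}|\omega|\big(\{y:|y-x|\le r\}\big).$$ Let $\beta>1$, $C\in\mathbb{R}$ and $0<R\le 1$, and suppose that $M_r(\omega)\le C|\log r|^{-\beta}$ for all $0<r<R$. Then, for all $0<r<R$, $$\frac{1}{|B_r(0)|}\int_{B_r(0)}\int_{\mathbb{R}^2}|u(x+h)-u(x)|^2\,dx\,dh\le\frac{C}{\beta-1}\,\|\omega\|_{\mathcal M}\,|\log r|^{1-\beta}.$$ -/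

import Mathlib

open MeasureTheory Set Metric
open scoped ENNReal

noncomputable section

namespace VortexSheet

/-- The Euclidean plane. Bounded Radon measures on it are the finite signed Borel measures,
that is, the terms of `SignedMeasure Plane`. -/
abbrev Plane : Type := EuclideanSpace ℝ (Fin 2)

/-- The norm `‖ω‖_𝓜 = |ω|(ℝ²)` (a finite number, as `|ω|` is a finite measure). -/
def massNorm (ω : SignedMeasure Plane) : ℝ :=
  (ω.totalVariation univ).toReal

/-- The vorticity maximal function `M_r(ω) = sup_x |ω|({y : |y - x| ≤ r})`. The supremum is taken
in `[0, ∞]` and is at most `|ω|(ℝ²) < ∞`. -/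
def vorticityMaximal (ω : SignedMeasure Plane) (r : ℝ) : ℝ :=
  (⨆ x : Plane, ω.totalVariation (closedBall x r)).toReal

/-- `ω ∈ H⁻¹_loc`: on every compact set `S`, the functional `φ ↦ ∫ φ dω` on the test functions
supported in `S` is bounded with respect to the `H¹` norm. -/
def MemHNegOneLoc (ω : SignedMeasure Plane) : Prop :=
  ∀ S : Set Plane, IsCompact S → ∃ A : ℝ, ∀ φ : Plane → ℝ, ContDiff ℝ (⊤ : ℕ∞) φ → tsupport φ ⊆ S →
    |∫ᵛ x, φ x ∂<•ω| ≤ A * Real.sqrt (∫ x, (φ x ^ 2 + ‖fderiv ℝ φ x‖ ^ 2))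

/-- The Biot–Savart kernel `K(x) = x^⊥ / (2π |x|²)` with `x^⊥ = (-x₂, x₁)` (and `K(0) = 0`). -/
def biotSavartKernel (x : Plane) : Plane :=
  (1 / (2 * Real.pi * ‖x‖ ^ 2)) • !₂[-x 1, x 0]

/-- The velocity `(K ∗ ω)(x) = ∫ K(x - y) dω(y)`. As `|K(x)| = 1 / (2π |x|)` is locally integrable
and bounded away from the origin, the integral converges absolutely for almost every `x`. -/
def biotSavart (ω : SignedMeasure Plane) (x : Plane) : Plane :=
  ∫ᵛ y, biotSavartKernel (x - y) ∂<•ω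

/-- The squared structure function `⨍_{B_r(0)} ∫_{ℝ²} |u(x + h) - u(x)|² dx dh ∈ [0, ∞]`. -/
def structureFunctionSq (u : Plane → Plane) (r : ℝ) : ℝ≥0∞ :=
  ⨍⁻ h in ball (0 : Plane) r, (∫⁻ x : Plane, ‖u (x + h) - u x‖ₑ ^ 2) ∂volume

end VortexSheet

end

namespace VortexSheet
open Complex Real Filter Topology
open scoped ComplexConjugate

/-! Identify the plane with `ℂ`. Since `x^⊥` is multiplication by `i`, the velocity is `i/(2π)`
times the conjugate of a Cauchy potential `v(x) = ∫ w(y)/(x-y) dμ(y)`, where `μ` is the total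
variation and `w` a sign. Write `A` for averaging over the ball `B_r`. Expanding the square gives,
pointwise, `A_h|v(x+h)-v(x)|² = A|v|² - |v|² + 2 Re(conj(v - Av) v)`.

Formally `A|v|² - |v|²` has integral zero by translation invariance. As `v` need not be square
integrable, this is done with a tent cutoff of width `n`; the error is `r/n` times the local energy
on `B_{n+r}`, which grows only like `log n`.

In the cross term, `v - Av` is the potential of a kernel `q_r` supported in `B_r`
(`integral_ballMeasure_inv_add`). Hence `∫ conj(v - Av) v` is a double integral against `μ ⊗ μ` of
`∫ conj(q_r(x)) (x-z)⁻¹ dx` at `z = y - y'`. Circle averages of `x/(x-z)` are `0` or `1`, which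
bounds this kernel by `2π log⁺(r/|z|)` (`enorm_integral_conj_cauchyDefect_mul_le`). So the structure
function is at most the truncated logarithmic energy of `μ` (`structureFunctionSq_biotSavart_le`).

Finally `log⁺(r/|z|) = ∫_{|z|}^r ds/s`, so Tonelli bounds the energy by `‖ω‖ ∫_0^r M_s ds/s`, and
the assumed decay of `M_s` makes the last integral explicit. -/

/-! ### Circle averages and polar coordinates -/

theorem circleAverage_mul_sub_inv_of_lt {w : ℂ} {s : ℝ} (hw : ‖w‖ < s) :
    circleAverage (fun z ↦ z * (z - w)⁻¹) 0 s = 1 := by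
  have hs : 0 < s := (norm_nonneg w).trans_lt hw
  rw [circleAverage_eq_circleIntegral hs.ne']
  have h : (∮ z in C(0, s), (z - 0)⁻¹ • (z * (z - w)⁻¹)) = ∮ z in C(0, s), (z - w)⁻¹ := by
    refine circleIntegral.integral_congr hs.le fun z hz ↦ ?_
    have hz0 : z ≠ 0 := by
      rintro rfl
      simp at hz
      exact hs.ne hz
    simp [hz0]
  rw [h, circleIntegral.integral_sub_inv_of_mem_ball (by simpa using hw), smul_eq_mul,
    inv_mul_cancel₀ two_pi_I_ne_zero]

/-- With the pole outside the disc the function is holomorphic and vanishes at the centre, so the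
mean value property applies. Together with the previous case this is Newton's shell theorem: the
average jumps from `0` to `1` as the circle crosses the pole. -/
theorem circleAverage_mul_sub_inv_of_gt {w : ℂ} {s : ℝ} (hs : 0 < s) (hw : s < ‖w‖) :
    circleAverage (fun z ↦ z * (z - w)⁻¹) 0 s = 0 := by
  have h : DiffContOnCl ℂ (fun z : ℂ ↦ z * (z - w)⁻¹) (ball 0 |s|) := by
    refine DifferentiableOn.diffContOnCl fun z hz ↦ ?_
    have hz' : ‖z‖ ≤ s := by
      have := closure_ball_subset_closedBall hz
      rwa [mem_closedBall_zero_iff, abs_of_pos hs] at this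
    have hzw : z - w ≠ 0 := by
      rw [sub_ne_zero]
      rintro rfl
      exact absurd hw hz'.not_gt
    fun_prop (disch := assumption)
  simpa using h.circleAverage

theorem measurable_polarCoord_symm :
    Measurable fun p : ℝ × ℝ ↦ Complex.polarCoord.symm p := by
  simp only [Complex.polarCoord_symm_apply]
  fun_prop

theorem integral_eq_integral_circleAverage {f : ℂ → ℂ} (hm : Measurable f) (hf : Integrable f) :
    ∫ z, f z = ∫ s in Ioi (0 : ℝ), (2 * π * s) • circleAverage f 0 s := by
  have hint : IntegrableOn (fun p : ℝ × ℝ ↦ p.1 • f (Complex.polarCoord.symm p))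
      (Ioi (0 : ℝ) ×ˢ Ioo (-π) π) (volume.prod volume) := by
    have hm' : Measurable fun p : ℝ × ℝ ↦ f (Complex.polarCoord.symm p) :=
      hm.comp measurable_polarCoord_symm
    refine ⟨(measurable_fst.smul hm').aestronglyMeasurable, ?_⟩
    have h := Complex.lintegral_comp_polarCoord_symm fun z ↦ ‖f z‖ₑ
    rw [show polarCoord.target = Ioi (0 : ℝ) ×ˢ Ioo (-π) π from rfl] at h
    rw [HasFiniteIntegral, ← Measure.volume_eq_prod]
    refine lt_of_eq_of_lt ?_ (h.trans_lt hf.2)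
    refine setLIntegral_congr_fun (measurableSet_Ioi.prod measurableSet_Ioo) fun p hp ↦ ?_
    have hp' : 0 < p.1 := hp.1
    rw [enorm_smul, Real.enorm_of_nonneg hp'.le, smul_eq_mul]
  rw [← Complex.integral_comp_polarCoord_symm, show polarCoord.target = Ioi (0 : ℝ) ×ˢ Ioo (-π) π from rfl]
  rw [Measure.volume_eq_prod, setIntegral_prod _ hint]
  refine setIntegral_congr_fun measurableSet_Ioi fun s hs ↦ ?_
  simp only
  rw [integral_smul, mul_comm, mul_smul s, circleAverage_eq_integral_add (-π), smul_smul (2 * π),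
    mul_inv_cancel₀ two_pi_pos.ne', one_smul, ← integral_Ioc_eq_integral_Ioo,
    ← intervalIntegral.integral_of_le (by linarith [pi_pos]),
    intervalIntegral.integral_comp_add_right (fun θ ↦ f (circleMap 0 s θ))]
  congr 1
  rw [zero_add, show 2 * π + -π = π by ring]
  simp [circleMap, Complex.exp_mul_I]

theorem lintegral_comp_norm (f : ℝ → ℝ≥0∞) (hf : Measurable f):
    ∫⁻ z : ℂ, f ‖z‖ = ENNReal.ofReal (2 * π) * ∫⁻ s in Ioi (0 : ℝ), ENNReal.ofReal s * f s := by
  have hm' : Measurable fun p : ℝ × ℝ ↦ ENNReal.ofReal p.1 • f ‖Complex.polarCoord.symm p‖ :=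
    (ENNReal.measurable_ofReal.comp measurable_fst).smul (hf.comp measurable_polarCoord_symm.norm)
  rw [← Complex.lintegral_comp_polarCoord_symm, show polarCoord.target = Ioi (0 : ℝ) ×ˢ Ioo (-π) π from rfl,
    Measure.volume_eq_prod, setLIntegral_prod _ hm'.aemeasurable, ← lintegral_const_mul _ (by fun_prop)]
  refine setLIntegral_congr_fun measurableSet_Ioi fun s hs ↦ ?_
  simp only [Complex.norm_polarCoord_symm, lintegral_const, smul_eq_mul, abs_of_pos (show 0 < s from hs)]
  simp only [Measure.restrict_apply_univ, Real.volume_Ioo, sub_neg_eq_add, ← two_mul]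
  ring

/-! ### Logarithmic kernel and local products of Cauchy kernels -/

/-- The truncated logarithmic kernel `log⁺ (r / ‖z‖)`, written as `∫_{‖z‖}^r ds / s`. -/
noncomputable def logKernel (r : ℝ) (z : ℂ) : ℝ≥0∞ :=
  ∫⁻ s in Ioo 0 r, if ‖z‖ ≤ s then ENNReal.ofReal s⁻¹ else 0

theorem measurable_logKernel_integrand :
    Measurable fun p : ℂ × ℝ ↦ if ‖p.1‖ ≤ p.2 then ENNReal.ofReal p.2⁻¹ else 0 :=
  Measurable.ite (measurableSet_le (by fun_prop) (by fun_prop)) (by fun_prop) (by fun_prop)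

theorem measurable_logKernel (r : ℝ) : Measurable (logKernel r) :=
  measurable_logKernel_integrand.lintegral_prod_right'

/-- The extra range `r ≤ s < ρ` contributes at most `∫ ds/s`. This is why local energies grow only
logarithmically with the radius. -/
theorem logKernel_le_add {r ρ : ℝ} (hr : 0 < r) (hρ : r ≤ ρ) (z : ℂ) :
    logKernel ρ z ≤ logKernel r z + ENNReal.ofReal (Real.log (ρ / r)) := by
  have hsub : Ioo 0 ρ ⊆ Ioo 0 r ∪ Ico r ρ := by
    intro s hs
    rcases lt_or_ge s r with h | h
    · exact Or.inl ⟨hs.1, h⟩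
    · exact Or.inr ⟨h, hs.2⟩
  refine (lintegral_mono_set hsub).trans ((lintegral_union_le _ _ _).trans ?_)
  refine add_le_add le_rfl ?_
  have h1 : ∫⁻ s in Ico r ρ, (if ‖z‖ ≤ s then ENNReal.ofReal s⁻¹ else 0) ≤
      ∫⁻ s in Ico r ρ, ENNReal.ofReal s⁻¹ := by
    refine lintegral_mono fun s ↦ ?_
    split_ifs <;> simp
  refine h1.trans (le_of_eq ?_)
  have hc : ContinuousOn (fun s : ℝ ↦ s⁻¹) (Icc r ρ) :=
    continuousOn_inv₀.mono fun s hs ↦ (hr.trans_le hs.1).ne'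
  rw [← integral_inv_of_pos hr (hr.trans_le hρ), intervalIntegral.integral_of_le hρ,
    ← restrict_Ico_eq_restrict_Ioc,
    ofReal_integral_eq_lintegral_ofReal]
  · exact (hc.integrableOn_Icc).mono_set Ico_subset_Icc_self
  · filter_upwards [ae_restrict_mem measurableSet_Ico] with s hs
    exact inv_nonneg.2 (hr.le.trans hs.1)

/-- A majorant of half of the product of two Cauchy kernels with poles at distance `d`. -/
noncomputable def cauchyMajorant (d : ℝ) (t : ℝ) : ℝ≥0∞ := ENNReal.ofReal (2 * (t * max t d)⁻¹)

/-- The larger of `‖a‖`, `‖b‖` is at least half of `‖a - b‖` by the triangle inequality, so its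
inverse is at most `2 / max t d`, with `t` the smaller norm and `d = ‖a - b‖`. -/
theorem enorm_inv_mul_le (a b : ℂ) :
    ‖a⁻¹‖ₑ * ‖b⁻¹‖ₑ ≤ cauchyMajorant ‖a - b‖ ‖a‖ + cauchyMajorant ‖a - b‖ ‖b‖ := by
  have key : ∀ a b : ℂ, ‖a‖ ≤ ‖b‖ → ‖a⁻¹‖ₑ * ‖b⁻¹‖ₑ ≤ cauchyMajorant ‖a - b‖ ‖a‖ := by
    intro a b hab
    rw [← enorm_mul, ← ofReal_norm, cauchyMajorant]
    refine ENNReal.ofReal_le_ofReal ?_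
    rcases eq_or_ne a 0 with rfl | ha
    · simp
    have ha' : 0 < ‖a‖ := norm_pos_iff.2 ha
    have hb' : 0 < ‖b‖ := ha'.trans_le hab
    have hd : ‖a - b‖ ≤ 2 * ‖b‖ := (norm_sub_le a b).trans (by linarith)
    have hm : max ‖a‖ ‖a - b‖ ≤ 2 * ‖b‖ := max_le (by linarith) hd
    have hm0 : 0 < max ‖a‖ ‖a - b‖ := lt_max_of_lt_left ha'
    rw [norm_mul, norm_inv, norm_inv, mul_inv, mul_left_comm]
    refine mul_le_mul_of_nonneg_left ?_ (by positivity)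
    rw [← div_eq_mul_inv, le_div_iff₀ hm0, inv_mul_le_iff₀ hb']
    linarith
  rcases le_total ‖a‖ ‖b‖ with h | h
  · exact (key a b h).trans le_self_add
  · rw [mul_comm, norm_sub_rev]
    exact (key b a h).trans le_add_self

theorem measurable_cauchyMajorant (d : ℝ) : Measurable (cauchyMajorant d) := by
  unfold cauchyMajorant
  fun_prop

/-- In polar coordinates the density is `2 / max s ‖z‖`: radii below `‖z‖` contribute a bounded
amount, the others the logarithmic kernel. -/
theorem lintegral_ball_cauchyMajorant_le {ρ : ℝ} (z : ℂ) :
    ∫⁻ x in ball (0 : ℂ) ρ, cauchyMajorant ‖z‖ ‖x‖ ≤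
      ENNReal.ofReal (4 * π) * (1 + logKernel ρ z) := by
  have h1 : ∫⁻ x in ball (0 : ℂ) ρ, cauchyMajorant ‖z‖ ‖x‖ =
      ∫⁻ x : ℂ, (Iio ρ).indicator (cauchyMajorant ‖z‖) ‖x‖ := by
    rw [← lintegral_indicator measurableSet_ball]
    congr with x
    simp [indicator]
  rw [h1, lintegral_comp_norm _ ((measurable_cauchyMajorant _).indicator measurableSet_Iio),
    show 4 * π = 2 * π * 2 by ring, ENNReal.ofReal_mul two_pi_pos.le, mul_assoc]
  gcongr
  have h2 : ∀ s ∈ Ioi (0 : ℝ),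
      ENNReal.ofReal s * (Iio ρ).indicator (cauchyMajorant ‖z‖) s ≤
      (Ioo 0 ‖z‖).indicator (fun _ ↦ ENNReal.ofReal (2 * ‖z‖⁻¹)) s +
        ENNReal.ofReal 2 * (Ioo 0 ρ).indicator
          (fun s ↦ if ‖z‖ ≤ s then ENNReal.ofReal s⁻¹ else 0) s := by
    intro s hs
    have hs0 : 0 < s := hs
    by_cases hsρ : s < ρ
    · rw [indicator_of_mem (show s ∈ Iio ρ from hsρ), cauchyMajorant,
        ← ENNReal.ofReal_mul hs0.le, mul_inv, mul_left_comm, mul_inv_cancel_left₀ hs0.ne']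
      rw [indicator_of_mem (show s ∈ Ioo 0 ρ from ⟨hs0, hsρ⟩)]
      rcases le_or_gt ‖z‖ s with h | h
      · rw [if_pos h, max_eq_left h, ENNReal.ofReal_mul zero_le_two]
        exact le_add_self
      · rw [indicator_of_mem (show s ∈ Ioo 0 ‖z‖ from ⟨hs0, h⟩), max_eq_right h.le]
        exact le_self_add
    · rw [indicator_of_notMem (show s ∉ Iio ρ from hsρ)]
      simp
  refine (setLIntegral_mono' measurableSet_Ioi h2).trans ?_
  have hm : Measurable fun s ↦ if ‖z‖ ≤ s then ENNReal.ofReal s⁻¹ else 0 :=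
    measurable_logKernel_integrand.comp measurable_prodMk_left
  rw [lintegral_add_left (measurable_const.indicator measurableSet_Ioo),
    lintegral_const_mul _ (hm.indicator measurableSet_Ioo), mul_add, mul_one]
  refine add_le_add ?_ ?_
  · refine (setLIntegral_le_lintegral _ _).trans ?_
    rw [lintegral_indicator measurableSet_Ioo, lintegral_const, Measure.restrict_apply_univ,
      Real.volume_Ioo, sub_zero, ← ENNReal.ofReal_mul (by positivity)]
    refine ENNReal.ofReal_le_ofReal ?_
    rcases eq_or_ne ‖z‖ 0 with h | h
    · simp [h]
    · rw [inv_mul_cancel_right₀ h]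
  · gcongr
    refine (setLIntegral_le_lintegral _ _).trans ?_
    rw [lintegral_indicator measurableSet_Ioo, logKernel]

/-- Points farther than `ρ` from `y` see a majorant of at most `2/ρ²`, hence a total of at most
`2π`; the others are covered by the centred case. -/
theorem lintegral_ball_cauchyMajorant_sub_le {ρ : ℝ} (hρ : 0 < ρ) (z y : ℂ) :
    ∫⁻ x in ball (0 : ℂ) ρ, cauchyMajorant ‖z‖ ‖x - y‖ ≤
      ENNReal.ofReal (4 * π) * (1 + logKernel ρ z) + ENNReal.ofReal (2 * π) := by
  have h1 : ∀ x ∈ ball (0 : ℂ) ρ, cauchyMajorant ‖z‖ ‖x - y‖ ≤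
      (ball (0 : ℂ) ρ).indicator (fun x ↦ cauchyMajorant ‖z‖ ‖x‖) (x - y) +
        ENNReal.ofReal (2 * (ρ ^ 2)⁻¹) := by
    intro x _
    by_cases h : x - y ∈ ball (0 : ℂ) ρ
    · rw [indicator_of_mem h]
      exact le_self_add
    · rw [indicator_of_notMem h, zero_add]
      rw [mem_ball_zero_iff, not_lt] at h
      refine ENNReal.ofReal_le_ofReal ?_
      gcongr
      rw [sq]
      gcongr
      exact h.trans (le_max_left _ _)
  have hm : Measurable ((ball (0 : ℂ) ρ).indicator (fun x ↦ cauchyMajorant ‖z‖ ‖x‖)) :=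
    ((measurable_cauchyMajorant _).comp measurable_norm).indicator measurableSet_ball
  refine (setLIntegral_mono' measurableSet_ball h1).trans ?_
  rw [lintegral_add_right _ measurable_const]
  refine add_le_add ?_ ?_
  · refine (setLIntegral_le_lintegral _ _).trans ?_
    rw [lintegral_sub_right_eq_self, lintegral_indicator measurableSet_ball]
    exact lintegral_ball_cauchyMajorant_le z
  · rw [lintegral_const, Measure.restrict_apply_univ, Complex.volume_ball,
      ← ENNReal.ofReal_pow hρ.le, ← ENNReal.ofReal_coe_nnreal,
      ← ENNReal.ofReal_mul (by positivity), ← ENNReal.ofReal_mul (by positivity)]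
    refine ENNReal.ofReal_le_ofReal (le_of_eq ?_)
    simp only [NNReal.coe_real_pi]
    field_simp

theorem lintegral_ball_cauchy_mul_cauchy_le {ρ : ℝ} (hρ : 0 < ρ) (y y' : ℂ) :
    ∫⁻ x in ball (0 : ℂ) ρ, ‖(x - y)⁻¹‖ₑ * ‖(x - y')⁻¹‖ₑ ≤
      ENNReal.ofReal (12 * π) + ENNReal.ofReal (8 * π) * logKernel ρ (y - y') := by
  have h1 : ∀ x : ℂ, ‖(x - y)⁻¹‖ₑ * ‖(x - y')⁻¹‖ₑ ≤
      cauchyMajorant ‖y - y'‖ ‖x - y‖ + cauchyMajorant ‖y - y'‖ ‖x - y'‖ := by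
    intro x
    have := enorm_inv_mul_le (x - y) (x - y')
    rwa [sub_sub_sub_cancel_left, norm_sub_rev y' y] at this
  have hm : ∀ y'' : ℂ, Measurable fun x : ℂ ↦ cauchyMajorant ‖y - y'‖ ‖x - y''‖ := fun y'' ↦
    (measurable_cauchyMajorant _).comp (by fun_prop)
  refine (lintegral_mono h1).trans ?_
  rw [lintegral_add_left (hm y)]
  refine (add_le_add (lintegral_ball_cauchyMajorant_sub_le hρ _ _)
    (lintegral_ball_cauchyMajorant_sub_le hρ _ _)).trans (le_of_eq ?_)
  have e1 : ENNReal.ofReal (12 * π) =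
      ENNReal.ofReal (4 * π) + ENNReal.ofReal (2 * π) + ENNReal.ofReal (4 * π)
        + ENNReal.ofReal (2 * π) := by
    rw [← ENNReal.ofReal_add, ← ENNReal.ofReal_add, ← ENNReal.ofReal_add]
    · ring_nf
    all_goals positivity
  have e2 : ENNReal.ofReal (8 * π) = ENNReal.ofReal (4 * π) + ENNReal.ofReal (4 * π) := by
    rw [← ENNReal.ofReal_add]
    · ring_nf
    all_goals positivity
  rw [e1, e2]
  ring

/-! ### Ball averages of the Cauchy kernel -/

/-- The difference between the kernel `x⁻¹` and its average over balls of radius `r`. -/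
noncomputable def cauchyDefect (r : ℝ) (x : ℂ) : ℂ :=
  if ‖x‖ < r then ((1 - ‖x‖ ^ 2 / r ^ 2 : ℝ) : ℂ) * x⁻¹ else 0

theorem measurable_cauchyDefect (r : ℝ) : Measurable (cauchyDefect r) :=
  Measurable.ite (measurableSet_lt (by fun_prop) (by fun_prop)) (by fun_prop) (by fun_prop)

theorem enorm_cauchyDefect_le (r : ℝ) (x : ℂ) :
    ‖cauchyDefect r x‖ₑ ≤ (ball (0 : ℂ) r).indicator (fun x ↦ ‖x⁻¹‖ₑ) x := by
  by_cases h : ‖x‖ < r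
  · rw [indicator_of_mem (mem_ball_zero_iff.2 h), cauchyDefect, if_pos h, enorm_mul]
    refine mul_le_of_le_one_left' ?_
    have hr : 0 < r := (norm_nonneg x).trans_lt h
    have h1 : ‖x‖ ^ 2 / r ^ 2 ≤ 1 := by
      rw [div_le_one (by positivity)]
      gcongr
    rw [← ofReal_norm, Complex.norm_real, Real.norm_of_nonneg (by linarith)]
    refine ENNReal.ofReal_le_one.2 ?_
    linarith [show 0 ≤ ‖x‖ ^ 2 / r ^ 2 by positivity]
  · simp [cauchyDefect, h]

/-- The defect is dominated by the Cauchy kernel on its ball. This coarse bound serves only for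
absolute convergence. -/
theorem lintegral_cauchyDefect_mul_le {r : ℝ} (hr : 0 < r) (y y' : ℂ) :
    ∫⁻ x, ‖cauchyDefect r (x - y')‖ₑ * ‖(x - y)⁻¹‖ₑ ≤
      ENNReal.ofReal (12 * π) + ENNReal.ofReal (8 * π) * logKernel r (y - y') := by
  rw [← lintegral_add_right_eq_self _ y']
  simp only [add_sub_cancel_right, add_sub_assoc]
  calc ∫⁻ x, ‖cauchyDefect r x‖ₑ * ‖(x + (y' - y))⁻¹‖ₑ
      ≤ ∫⁻ x, (ball (0 : ℂ) r).indicator (fun x ↦ ‖(x - (y - y'))⁻¹‖ₑ * ‖(x - 0)⁻¹‖ₑ) x := by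
        refine lintegral_mono fun x ↦ ?_
        refine (mul_le_mul_left (enorm_cauchyDefect_le r x) _).trans ?_
        by_cases h : x ∈ ball (0 : ℂ) r
        · rw [indicator_of_mem h, indicator_of_mem h, sub_zero, mul_comm,
            show x + (y' - y) = x - (y - y') by ring]
        · simp [indicator_of_notMem h]
    _ ≤ _ := by
        rw [lintegral_indicator measurableSet_ball]
        simpa using lintegral_ball_cauchy_mul_cauchy_le hr (y - y') 0

/-- Cancellation over circles leaves only radii `s > ‖z‖`, where the polar integrand is `2π s⁻¹ (1 -
s²/r²) ≤ 2π s⁻¹`. Unlike the absolute estimate, there is no additive constant, so the final bound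
can vanish with `r`. -/
theorem enorm_integral_conj_cauchyDefect_mul_le {r : ℝ} (hr : 0 < r) (z : ℂ) :
    ‖∫ x, conj (cauchyDefect r x) * (x - z)⁻¹‖ₑ ≤
      ENNReal.ofReal (2 * π) * logKernel r z := by
  rcases eq_or_ne (logKernel r z) ∞ with hz | hz
  · rw [hz, ENNReal.mul_top (by simp [pi_pos])]
    exact le_top
  have hm : Measurable fun x ↦ conj (cauchyDefect r x) * (x - z)⁻¹ :=
    (continuous_conj.measurable.comp (measurable_cauchyDefect r)).mul (by fun_prop)
  have hint : Integrable fun x ↦ conj (cauchyDefect r x) * (x - z)⁻¹ := by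
    refine ⟨hm.aestronglyMeasurable, ?_⟩
    have h := lintegral_cauchyDefect_mul_le hr z 0
    simp only [sub_zero] at h
    rw [HasFiniteIntegral]
    simp only [enorm_mul, RCLike.enorm_conj]
    exact h.trans_lt (by finiteness)
  rw [integral_eq_integral_circleAverage hm hint]
  refine (enorm_integral_le_lintegral_enorm _).trans ?_
  have hne : ∀ᵐ s ∂(volume.restrict (Ioi (0 : ℝ))), s ≠ ‖z‖ :=
    ae_restrict_of_ae (Measure.ae_ne volume _)
  have hle : ∀ᵐ s ∂(volume.restrict (Ioi (0 : ℝ))),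
      ‖(2 * π * s) • circleAverage (fun x ↦ conj (cauchyDefect r x) * (x - z)⁻¹) 0 s‖ₑ ≤
        ENNReal.ofReal (2 * π) *
          (Ioo 0 r).indicator (fun s ↦ if ‖z‖ ≤ s then ENNReal.ofReal s⁻¹ else 0) s := by
    filter_upwards [hne, ae_restrict_mem measurableSet_Ioi] with s hsz hs
    have hs0 : 0 < s := hs
    by_cases hsr : s < r
    -- On the circle of radius `s` one has `conj x⁻¹ = x / s²`, which makes the integrand a multiple
    -- of `x / (x - z)`.
    · have hcongr : circleAverage (fun x ↦ conj (cauchyDefect r x) * (x - z)⁻¹) 0 s =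
          ((1 - s ^ 2 / r ^ 2) * (s ^ 2)⁻¹) • circleAverage (fun x ↦ x * (x - z)⁻¹) 0 s := by
        rw [← circleAverage_fun_smul]
        refine circleAverage_congr_sphere fun x hx ↦ ?_
        have hxs : ‖x‖ = s := by simpa [abs_of_pos hs0] using hx
        simp only [cauchyDefect, hxs, if_pos hsr, real_smul]
        rw [Complex.inv_def, map_mul, map_mul, conj_ofReal, conj_ofReal, conj_conj,
          normSq_eq_norm_sq, hxs]
        push_cast
        ring
      rw [hcongr, indicator_of_mem (show s ∈ Ioo 0 r from ⟨hs0, hsr⟩)]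
      rcases lt_or_gt_of_ne hsz with h | h
      · rw [circleAverage_mul_sub_inv_of_gt hs0 h]
        simp
      · rw [circleAverage_mul_sub_inv_of_lt h, if_pos h.le, ← ENNReal.ofReal_mul two_pi_pos.le,
          smul_smul, enorm_smul, enorm_one, mul_one]
        have h1 : s ^ 2 / r ^ 2 ≤ 1 := by
          rw [div_le_one (by positivity)]
          gcongr
        have h2 : 0 ≤ s ^ 2 / r ^ 2 := by positivity
        rw [Real.enorm_of_nonneg (by have := sub_nonneg.2 h1; positivity)]
        refine ENNReal.ofReal_le_ofReal ?_
        have h3 : 2 * π * s * ((1 - s ^ 2 / r ^ 2) * (s ^ 2)⁻¹) =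
            2 * π * s⁻¹ * (1 - s ^ 2 / r ^ 2) := by
          field_simp
        rw [h3]
        refine mul_le_of_le_one_right (by positivity) (by linarith)
    · have hcongr : circleAverage (fun x ↦ conj (cauchyDefect r x) * (x - z)⁻¹) 0 s =
          circleAverage (fun _ ↦ (0 : ℂ)) 0 s := by
        refine circleAverage_congr_sphere fun x hx ↦ ?_
        have hxs : ‖x‖ = s := by simpa [abs_of_pos hs0] using hx
        simp [cauchyDefect, hxs, hsr]
      rw [hcongr, circleAverage_const]
      simp
  refine (lintegral_mono_ae hle).trans ?_
  have hm2 : Measurable fun s ↦ if ‖z‖ ≤ s then ENNReal.ofReal s⁻¹ else 0 :=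
    measurable_logKernel_integrand.comp measurable_prodMk_left
  rw [lintegral_const_mul _ (hm2.indicator measurableSet_Ioo)]
  gcongr
  refine (setLIntegral_le_lintegral _ _).trans ?_
  rw [lintegral_indicator measurableSet_Ioo, logKernel]

theorem integrableOn_ball_inv (ρ : ℝ) : IntegrableOn (fun x : ℂ ↦ x⁻¹) (ball 0 ρ) := by
  refine ⟨measurable_inv.aestronglyMeasurable, ?_⟩
  rw [HasFiniteIntegral]
  have h1 : ∫⁻ x in ball (0 : ℂ) ρ, ‖x⁻¹‖ₑ =
      ∫⁻ x : ℂ, (Iio ρ).indicator (fun s ↦ ENNReal.ofReal s⁻¹) ‖x‖ := by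
    rw [← lintegral_indicator measurableSet_ball]
    congr with x
    simp [indicator, ← ofReal_norm]
  have hm : Measurable fun s : ℝ ↦ ENNReal.ofReal s⁻¹ := by fun_prop
  rw [h1, lintegral_comp_norm _ (hm.indicator measurableSet_Iio)]
  refine ENNReal.mul_lt_top (by finiteness) ?_
  have h2 : ∀ s ∈ Ioi (0 : ℝ), ENNReal.ofReal s * (Iio ρ).indicator (fun s ↦ ENNReal.ofReal s⁻¹) s
      ≤ (Ioo 0 ρ).indicator (fun _ ↦ 1) s := by
    intro s hs
    have hs0 : 0 < s := hs
    by_cases h : s < ρ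
    · rw [indicator_of_mem (show s ∈ Iio ρ from h), indicator_of_mem (show s ∈ Ioo 0 ρ from ⟨hs0, h⟩),
        ← ENNReal.ofReal_mul hs0.le, mul_inv_cancel₀ hs0.ne', ENNReal.ofReal_one]
    · simp [h]
  refine (setLIntegral_mono' measurableSet_Ioi h2).trans_lt ?_
  refine (setLIntegral_le_lintegral _ _).trans_lt ?_
  rw [lintegral_indicator measurableSet_Ioo]
  simp

theorem integrableOn_ball_inv_add (r : ℝ) (x : ℂ) :
    IntegrableOn (fun h : ℂ ↦ (x + h)⁻¹) (ball 0 r) := by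
  have h := (integrableOn_ball_inv (r + ‖x‖))
  rw [← integrable_indicator_iff measurableSet_ball] at h ⊢
  refine (h.comp_add_left x).mono
    ((Measurable.indicator (by fun_prop) measurableSet_ball).aestronglyMeasurable)
    (Eventually.of_forall fun y ↦ ?_)
  by_cases hy : y ∈ ball (0 : ℂ) r
  · have hxy : x + y ∈ ball (0 : ℂ) (r + ‖x‖) := by
      rw [mem_ball_zero_iff] at hy ⊢
      linarith [norm_add_le x y]
    simp only [indicator_of_mem hy, indicator_of_mem hxy, le_refl]
  · rw [indicator_of_notMem hy, norm_zero]
    positivity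

/-- The circle average of `1/(x+h)` over `‖h‖ = s` is `x⁻¹` for `s < ‖x‖` and `0` for `s > ‖x‖`;
integrating `2πs` up to `min r ‖x‖` gives the value. -/
theorem setIntegral_ball_inv_add {r : ℝ} (hr : 0 < r) (x : ℂ) :
    ∫ h in ball (0 : ℂ) r, (x + h)⁻¹ = (π * r ^ 2 : ℝ) * (x⁻¹ - cauchyDefect r x) := by
  -- At the origin `0⁻¹ = 0` makes the right side zero, and the left side vanishes by oddness.
  rcases eq_or_ne x 0 with rfl | hx
  · have h0 : ∫ h in ball (0 : ℂ) r, h⁻¹ = 0 := by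
      have h1 : ∫ h in ball (0 : ℂ) r, h⁻¹ = - ∫ h in ball (0 : ℂ) r, h⁻¹ := by
        rw [← integral_indicator measurableSet_ball, ← integral_neg, ← integral_neg_eq_self]
        congr with h
        by_cases hh : h ∈ ball (0 : ℂ) r
        · simp_all [indicator, inv_neg]
        · simp_all [indicator, not_lt.2]
      exact self_eq_neg.1 h1
    simp [cauchyDefect, h0]
  have hx0 : 0 < ‖x‖ := norm_pos_iff.2 hx
  rw [← integral_indicator measurableSet_ball, integral_eq_integral_circleAverage
    (Measurable.indicator (by fun_prop) measurableSet_ball)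
    ((integrable_indicator_iff measurableSet_ball).2 (integrableOn_ball_inv_add r x))]
  have hae : ∀ᵐ s ∂(volume.restrict (Ioi (0 : ℝ))),
      (2 * π * s) • circleAverage ((ball (0 : ℂ) r).indicator fun h ↦ (x + h)⁻¹) 0 s =
        (Iio (min r ‖x‖)).indicator (fun s : ℝ ↦ ((2 * π * s : ℝ) : ℂ) * x⁻¹) s := by
    filter_upwards [ae_restrict_of_ae (Measure.ae_ne volume ‖x‖),
      ae_restrict_mem measurableSet_Ioi] with s hsx hs
    have hs0 : 0 < s := hs
    by_cases hsr : s < r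
    · have hci : CircleIntegrable (fun h ↦ h * (h - -x)⁻¹) 0 s := by
        refine ContinuousOn.circleIntegrable hs0.le fun h hh ↦ ?_
        have hne : h - -x ≠ 0 := by
          rw [sub_neg_eq_add]
          intro h0
          rw [eq_neg_of_add_eq_zero_left h0] at hh
          exact hsx (by simpa using hh.symm)
        exact ContinuousAt.continuousWithinAt (by fun_prop (disch := assumption))
      have hcongr : circleAverage ((ball (0 : ℂ) r).indicator fun h ↦ (x + h)⁻¹) 0 s =
          circleAverage (fun h ↦ x⁻¹ • (1 - h * (h - -x)⁻¹)) 0 s := by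
        refine circleAverage_congr_sphere fun h hh ↦ ?_
        have hhs : ‖h‖ = s := by simpa [abs_of_pos hs0] using hh
        have hne : x + h ≠ 0 := by
          intro h0
          rw [eq_neg_of_add_eq_zero_left h0, norm_neg] at hsx
          exact hsx hhs.symm
        rw [indicator_of_mem (by rw [mem_ball_zero_iff, hhs]; exact hsr)]
        simp only [smul_eq_mul, sub_neg_eq_add, add_comm h x]
        field_simp
        ring
      rw [hcongr, circleAverage_fun_smul, circleAverage_fun_sub
        (circleIntegrable_const _ _ _) hci, circleAverage_const]
      rcases lt_or_gt_of_ne hsx with h | h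
      · rw [circleAverage_mul_sub_inv_of_gt hs0 (by rwa [norm_neg]),
          indicator_of_mem (show s ∈ Iio (min r ‖x‖) from lt_min hsr h)]
        simp [real_smul]
      · rw [circleAverage_mul_sub_inv_of_lt (by rwa [norm_neg]),
          indicator_of_notMem (show s ∉ Iio (min r ‖x‖) by simp [h.le])]
        simp
    · have hcongr : circleAverage ((ball (0 : ℂ) r).indicator fun h ↦ (x + h)⁻¹) 0 s =
          circleAverage (fun _ ↦ (0 : ℂ)) 0 s := by
        refine circleAverage_congr_sphere fun h hh ↦ ?_
        have hhs : ‖h‖ = s := by simpa [abs_of_pos hs0] using hh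
        exact indicator_of_notMem (by rw [mem_ball_zero_iff, hhs]; exact hsr) _
      rw [hcongr, circleAverage_const,
        indicator_of_notMem (show s ∉ Iio (min r ‖x‖) by simp [not_lt.1 hsr])]
      simp
  have hmin : 0 ≤ min r ‖x‖ := (lt_min hr hx0).le
  rw [integral_congr_ae hae, integral_indicator measurableSet_Iio, Measure.restrict_restrict
    measurableSet_Iio, inter_comm, Ioi_inter_Iio, ← integral_Ioc_eq_integral_Ioo,
    ← intervalIntegral.integral_of_le hmin, intervalIntegral.integral_mul_const,
    intervalIntegral.integral_ofReal, intervalIntegral.integral_const_mul, integral_id]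
  unfold cauchyDefect
  split_ifs with h
  · rw [min_eq_right h.le]
    have : (r : ℂ) ≠ 0 := by exact_mod_cast hr.ne'
    push_cast
    field_simp
    ring
  · rw [min_eq_left (not_lt.1 h)]
    push_cast
    ring

/-! ### Potentials, energy and local square integrability -/

/-- The Cauchy potential `∫ w(y) / (x - y) dμ(y)` of the complex measure `w μ`. -/
noncomputable def cauchyPotential (μ : Measure ℂ) (w : ℂ → ℂ) (x : ℂ) : ℂ :=
  ∫ y, w y * (x - y)⁻¹ ∂μ

/-- The absolute Cauchy potential `∫ 1 / |x - y| dμ(y)`. -/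
noncomputable def absPotential (μ : Measure ℂ) (x : ℂ) : ℝ≥0∞ :=
  ∫⁻ y, ‖(x - y)⁻¹‖ₑ ∂μ

/-- The difference between the Cauchy potential and its average over balls of radius `r`. -/
noncomputable def defectPotential (r : ℝ) (μ : Measure ℂ) (w : ℂ → ℂ) (x : ℂ) : ℂ :=
  ∫ y, w y * cauchyDefect r (x - y) ∂μ

/-- The logarithmic energy of `μ`, with the kernel truncated at distance `r`. -/
noncomputable def logEnergy (r : ℝ) (μ : Measure ℂ) : ℝ≥0∞ :=
  ∫⁻ p, logKernel r (p.1 - p.2) ∂(μ.prod μ)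

/-- The uniform probability measure on the ball of radius `r` about the origin. -/
noncomputable def ballMeasure (r : ℝ) : Measure ℂ :=
  (volume (ball (0 : ℂ) r))⁻¹ • volume.restrict (ball 0 r)

theorem isProbabilityMeasure_ballMeasure {r : ℝ} (hr : 0 < r) :
    IsProbabilityMeasure (ballMeasure r) := by
  refine ⟨?_⟩
  rw [ballMeasure, Measure.smul_apply, Measure.restrict_apply_univ, smul_eq_mul]
  exact ENNReal.inv_mul_cancel (measure_ball_pos _ _ hr).ne' measure_ball_lt_top.ne

theorem ae_ballMeasure_mem (r : ℝ) : ∀ᵐ h ∂(ballMeasure r), h ∈ ball (0 : ℂ) r :=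
  Measure.ae_smul_measure (ae_restrict_mem measurableSet_ball) _

theorem integral_ballMeasure_inv_add {r : ℝ} (hr : 0 < r) (x : ℂ) :
    ∫ h, (x + h)⁻¹ ∂(ballMeasure r) = x⁻¹ - cauchyDefect r x := by
  have h0 : ((π * r ^ 2 : ℝ) : ℂ) ≠ 0 := by
    exact_mod_cast (by positivity : π * r ^ 2 ≠ 0)
  rw [ballMeasure, integral_smul_measure, setIntegral_ball_inv_add hr, Complex.volume_ball,
    ENNReal.toReal_inv, ENNReal.toReal_mul, ENNReal.toReal_pow, ENNReal.toReal_ofReal hr.le,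
    ENNReal.coe_toReal, NNReal.coe_real_pi, mul_comm (r ^ 2), real_smul, ← mul_assoc,
    ofReal_inv, inv_mul_cancel₀ h0, one_mul]

theorem measurable_absPotential (μ : Measure ℂ) [SFinite μ] : Measurable (absPotential μ) :=
  Measurable.lintegral_prod_right' (f := fun p : ℂ × ℂ ↦ ‖(p.1 - p.2)⁻¹‖ₑ) (by fun_prop)

theorem measurable_cauchyPotential (μ : Measure ℂ) [SFinite μ] {w : ℂ → ℂ} (hw : Measurable w) :
    Measurable (cauchyPotential μ w) :=
  (StronglyMeasurable.integral_prod_right' (f := fun p : ℂ × ℂ ↦ w p.2 * (p.1 - p.2)⁻¹)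
    (by fun_prop : Measurable _).stronglyMeasurable).measurable

theorem measurable_defectPotential (r : ℝ) (μ : Measure ℂ) [SFinite μ] {w : ℂ → ℂ}
    (hw : Measurable w) : Measurable (defectPotential r μ w) := by
  have hq := measurable_cauchyDefect r
  exact (StronglyMeasurable.integral_prod_right' (f := fun p : ℂ × ℂ ↦
    w p.2 * cauchyDefect r (p.1 - p.2)) (by fun_prop : Measurable _).stronglyMeasurable).measurable

theorem enorm_cauchyPotential_le (μ : Measure ℂ) {w : ℂ → ℂ} (hw1 : ∀ y, ‖w y‖ₑ ≤ 1) (x : ℂ) :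
    ‖cauchyPotential μ w x‖ₑ ≤ absPotential μ x := by
  refine (enorm_integral_le_lintegral_enorm _).trans (lintegral_mono fun y ↦ ?_)
  rw [enorm_mul]
  exact mul_le_of_le_one_left' (hw1 y)

theorem logEnergy_le_add (μ : Measure ℂ) [SFinite μ] {r ρ : ℝ} (hr : 0 < r) (hρ : r ≤ ρ) :
    logEnergy ρ μ ≤ logEnergy r μ + ENNReal.ofReal (Real.log (ρ / r)) * μ univ ^ 2 := by
  refine (lintegral_mono fun p ↦ logKernel_le_add hr hρ _).trans ?_
  rw [lintegral_add_right _ measurable_const, lintegral_const, ← univ_prod_univ,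
    Measure.prod_prod, sq, logEnergy]

/-- The square is an integral over `μ ⊗ μ` of products of two kernels; Tonelli reduces it to the
two-pole estimate. -/
theorem lintegral_ball_absPotential_sq_le (μ : Measure ℂ) [SFinite μ] {ρ : ℝ} (hρ : 0 < ρ) :
    ∫⁻ x in ball (0 : ℂ) ρ, absPotential μ x ^ 2 ≤
      ENNReal.ofReal (12 * π) * μ univ ^ 2 + ENNReal.ofReal (8 * π) * logEnergy ρ μ := by
  have h1 : ∀ x, absPotential μ x ^ 2 =
      ∫⁻ p : ℂ × ℂ, ‖(x - p.1)⁻¹‖ₑ * ‖(x - p.2)⁻¹‖ₑ ∂(μ.prod μ) := by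
    intro x
    rw [sq, absPotential, ← lintegral_prod_mul (by fun_prop) (by fun_prop)]
  have hL : Measurable fun p : ℂ × ℂ ↦ logKernel ρ (p.1 - p.2) :=
    (measurable_logKernel ρ).comp (by fun_prop)
  have hm : Measurable fun q : ℂ × ℂ × ℂ ↦ ‖(q.1 - q.2.1)⁻¹‖ₑ * ‖(q.1 - q.2.2)⁻¹‖ₑ := by fun_prop
  calc ∫⁻ x in ball (0 : ℂ) ρ, absPotential μ x ^ 2
      = ∫⁻ x in ball (0 : ℂ) ρ,
          ∫⁻ p : ℂ × ℂ, ‖(x - p.1)⁻¹‖ₑ * ‖(x - p.2)⁻¹‖ₑ ∂(μ.prod μ) :=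
        lintegral_congr fun x ↦ h1 x
    _ = ∫⁻ p : ℂ × ℂ, (∫⁻ x in ball (0 : ℂ) ρ,
          ‖(x - p.1)⁻¹‖ₑ * ‖(x - p.2)⁻¹‖ₑ) ∂(μ.prod μ) :=
        lintegral_lintegral_swap hm.aemeasurable
    _ ≤ ∫⁻ p : ℂ × ℂ, (ENNReal.ofReal (12 * π) +
          ENNReal.ofReal (8 * π) * logKernel ρ (p.1 - p.2)) ∂(μ.prod μ) :=
        lintegral_mono fun p ↦ lintegral_ball_cauchy_mul_cauchy_le hρ p.1 p.2
    _ = _ := by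
        rw [lintegral_add_left measurable_const, lintegral_const, ← univ_prod_univ,
          Measure.prod_prod, ← sq, lintegral_const_mul _ hL, logEnergy]

theorem exists_lintegral_ball_absPotential_sq_le (μ : Measure ℂ) [IsFiniteMeasure μ] {r : ℝ}
    (hr : 0 < r) (hE : logEnergy r μ ≠ ∞) :
    ∃ c₀ c₁ : ℝ≥0∞, c₀ ≠ ∞ ∧ c₁ ≠ ∞ ∧ ∀ ρ, r ≤ ρ →
      ∫⁻ x in ball (0 : ℂ) ρ, absPotential μ x ^ 2 ≤
        c₀ + c₁ * ENNReal.ofReal (Real.log (ρ / r)) := by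
  refine ⟨ENNReal.ofReal (12 * π) * μ univ ^ 2 + ENNReal.ofReal (8 * π) * logEnergy r μ,
    ENNReal.ofReal (8 * π) * μ univ ^ 2, by finiteness, by finiteness, fun ρ hρ ↦ ?_⟩
  refine (lintegral_ball_absPotential_sq_le μ (hr.trans_le hρ)).trans ?_
  grw [logEnergy_le_add μ hr hρ]
  apply le_of_eq
  ring

theorem lintegral_ball_absPotential_sq_ne_top (μ : Measure ℂ) [IsFiniteMeasure μ] {r : ℝ}
    (hr : 0 < r) (hE : logEnergy r μ ≠ ∞) (ρ : ℝ) :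
    ∫⁻ x in ball (0 : ℂ) ρ, absPotential μ x ^ 2 ≠ ∞ := by
  obtain ⟨c₀, c₁, h₀, h₁, h⟩ := exists_lintegral_ball_absPotential_sq_le μ hr hE
  refine ne_top_of_le_ne_top ?_ ((lintegral_mono_set (ball_subset_ball (le_max_right r ρ))).trans
    (h _ (le_max_left r ρ)))
  finiteness

theorem tendsto_div_mul_lintegral_ball_absPotential_sq (μ : Measure ℂ) [IsFiniteMeasure μ] {r : ℝ}
    (hr : 0 < r) (hE : logEnergy r μ ≠ ∞) :
    Tendsto (fun n : ℕ ↦ ENNReal.ofReal (r / n) *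
      ∫⁻ x in ball (0 : ℂ) (n + r), absPotential μ x ^ 2) atTop (𝓝 0) := by
  obtain ⟨c₀, c₁, h₀, h₁, h⟩ := exists_lintegral_ball_absPotential_sq_le μ hr hE
  have hle : ∀ n : ℕ, ENNReal.ofReal (r / n) *
      ∫⁻ x in ball (0 : ℂ) (n + r), absPotential μ x ^ 2 ≤
      c₀ * ENNReal.ofReal (r / n) +
        c₁ * ENNReal.ofReal (Real.log ((n + r) / r) ^ 1 / (1 * ((n + r) / r) + -1)) := by
    intro n
    grw [h _ (le_add_of_nonneg_left n.cast_nonneg)]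
    -- Here `r / n = 1 / (t - 1)` with `t = (n + r) / r`, so the error has the form `log t / (t -
    -- 1)`.
    have e : Real.log ((n + r) / r) ^ 1 / (1 * ((n + r) / r) + -1) =
        r / n * Real.log ((n + r) / r) := by
      rw [add_div, div_self hr.ne', pow_one, one_mul, add_neg_cancel_right, div_div_eq_mul_div]
      ring
    rw [e, ENNReal.ofReal_mul (by positivity)]
    apply le_of_eq
    ring
  have t₁ : Tendsto (fun n : ℕ ↦ ENNReal.ofReal (r / n)) atTop (𝓝 0) := by
    simpa using ENNReal.tendsto_ofReal (tendsto_const_div_atTop_nhds_zero_nat r)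
  have t₂ : Tendsto (fun n : ℕ ↦
      ENNReal.ofReal (Real.log ((n + r) / r) ^ 1 / (1 * ((n + r) / r) + -1))) atTop (𝓝 0) := by
    have hx : Tendsto (fun n : ℕ ↦ ((n : ℝ) + r) / r) atTop atTop :=
      (tendsto_atTop_add_const_right _ _ tendsto_natCast_atTop_atTop).atTop_div_const hr
    simpa using ENNReal.tendsto_ofReal
      ((Real.tendsto_pow_log_div_mul_add_atTop 1 (-1) 1 one_ne_zero).comp hx)
  have t : Tendsto (fun n : ℕ ↦ c₀ * ENNReal.ofReal (r / n) +
      c₁ * ENNReal.ofReal (Real.log ((n + r) / r) ^ 1 / (1 * ((n + r) / r) + -1))) atTop (𝓝 0) := by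
    simpa using (ENNReal.Tendsto.const_mul t₁ (Or.inr h₀)).add
      (ENNReal.Tendsto.const_mul t₂ (Or.inr h₁))
  exact tendsto_of_tendsto_of_tendsto_of_le_of_le tendsto_const_nhds t (fun _ ↦ zero_le) hle

theorem ae_of_forall_lintegral_ball_ne_top {f : ℂ → ℝ≥0∞} (hf : Measurable f)
    (h : ∀ n : ℕ, ∫⁻ x in ball (0 : ℂ) n, f x ≠ ∞) : ∀ᵐ x, f x < ∞ := by
  rw [← Measure.restrict_univ (μ := volume), ← iUnion_ball_nat (0 : ℂ), ae_restrict_iUnion_iff]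
  exact fun n ↦ ae_lt_top hf (h n)

theorem ae_absPotential_lt_top (μ : Measure ℂ) [IsFiniteMeasure μ] {r : ℝ}
    (hr : 0 < r) (hE : logEnergy r μ ≠ ∞) : ∀ᵐ x, absPotential μ x < ∞ := by
  have h := ae_of_forall_lintegral_ball_ne_top ((measurable_absPotential μ).pow_const 2)
    fun n ↦ lintegral_ball_absPotential_sq_ne_top μ hr hE n
  filter_upwards [h] with x hx
  exact (ENNReal.pow_lt_top_iff.1 hx).resolve_right two_ne_zero

theorem ae_lintegral_ballMeasure_absPotential_sq_lt_top (μ : Measure ℂ) [IsFiniteMeasure μ] {r : ℝ}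
    (hr : 0 < r) (hE : logEnergy r μ ≠ ∞) :
    ∀ᵐ x, ∫⁻ h, absPotential μ (x + h) ^ 2 ∂(ballMeasure r) < ∞ := by
  have := isProbabilityMeasure_ballMeasure hr
  have hV := measurable_absPotential μ
  have hm : Measurable fun p : ℂ × ℂ ↦ absPotential μ (p.1 + p.2) ^ 2 := by fun_prop
  refine ae_of_forall_lintegral_ball_ne_top hm.lintegral_prod_right' fun n ↦ ?_
  rw [lintegral_lintegral_swap hm.aemeasurable]
  refine ne_top_of_le_ne_top (lintegral_ball_absPotential_sq_ne_top μ hr hE (n + r)) ?_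
  calc ∫⁻ h, ∫⁻ x in ball (0 : ℂ) n, absPotential μ (x + h) ^ 2 ∂volume ∂(ballMeasure r)
      ≤ ∫⁻ _, ∫⁻ x in ball (0 : ℂ) (n + r), absPotential μ x ^ 2 ∂volume ∂(ballMeasure r) := by
        refine lintegral_mono_ae ?_
        filter_upwards [ae_ballMeasure_mem r] with h hh
        rw [← lintegral_indicator measurableSet_ball, ← lintegral_indicator measurableSet_ball,
          ← lintegral_add_right_eq_self ((ball (0 : ℂ) (n + r)).indicator _) h]
        refine lintegral_mono fun x ↦ ?_
        by_cases hx : x ∈ ball (0 : ℂ) n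
        · have hxh : x + h ∈ ball (0 : ℂ) (n + r) := by
            rw [mem_ball_zero_iff] at hx hh ⊢
            linarith [norm_add_le x h]
          rw [indicator_of_mem hx, indicator_of_mem hxh]
        · rw [indicator_of_notMem hx]
          exact zero_le
    _ = _ := by simp

/-- Fubini moves the average onto the kernel; finiteness of the two absolute potentials justifies
it. -/
theorem integral_ballMeasure_cauchyPotential {μ : Measure ℂ} [IsFiniteMeasure μ] {w : ℂ → ℂ}
    (hw : Measurable w) (hw1 : ∀ y, ‖w y‖ₑ ≤ 1) {r : ℝ} (hr : 0 < r) {x : ℂ}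
    (hx : absPotential μ x < ∞)
    (hxr : ∫⁻ h, absPotential μ (x + h) ∂(ballMeasure r) < ∞) :
    ∫ h, cauchyPotential μ w (x + h) ∂(ballMeasure r) =
      cauchyPotential μ w x - defectPotential r μ w x := by
  have := isProbabilityMeasure_ballMeasure hr
  have hq := measurable_cauchyDefect r
  have hint : Integrable (fun p : ℂ × ℂ ↦ w p.2 * (x + p.1 - p.2)⁻¹) ((ballMeasure r).prod μ) := by
    refine ⟨(by fun_prop : Measurable _).aestronglyMeasurable, ?_⟩
    rw [HasFiniteIntegral, lintegral_prod _ (by fun_prop)]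
    refine lt_of_le_of_lt (lintegral_mono fun h ↦ lintegral_mono fun y ↦ ?_) hxr
    rw [enorm_mul]
    exact mul_le_of_le_one_left' (hw1 y)
  have h1 : Integrable (fun y ↦ w y * (x - y)⁻¹) μ := by
    refine ⟨(by fun_prop : Measurable _).aestronglyMeasurable, ?_⟩
    refine lt_of_le_of_lt (lintegral_mono fun y ↦ ?_) hx
    rw [enorm_mul]
    exact mul_le_of_le_one_left' (hw1 y)
  have h2 : Integrable (fun y ↦ w y * cauchyDefect r (x - y)) μ := by
    refine ⟨(by fun_prop : Measurable _).aestronglyMeasurable, ?_⟩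
    refine lt_of_le_of_lt (lintegral_mono fun y ↦ ?_) hx
    rw [enorm_mul]
    refine (mul_le_of_le_one_left' (hw1 y)).trans ((enorm_cauchyDefect_le _ _).trans ?_)
    exact indicator_le_self _ _ _
  simp only [cauchyPotential, defectPotential]
  rw [integral_integral_swap hint, ← integral_sub h1 h2]
  refine integral_congr_ae (Eventually.of_forall fun y ↦ ?_)
  simp only
  rw [integral_const_mul, ← mul_sub, ← integral_ballMeasure_inv_add hr]
  simp only [add_sub_right_comm]

/-! ### Expansion of the averaged square -/

/-- The cross term `d` has no sign, so its positive and negative parts are put on opposite sides to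
avoid subtraction in `[0, ∞]`. -/
theorem ofReal_add_ofReal_neg_eq {a b c d : ℝ} (ha : 0 ≤ a) (hb : 0 ≤ b) (hc : 0 ≤ c)
    (h : b + c = a + 2 * d) :
    ENNReal.ofReal b + ENNReal.ofReal c + 2 * ENNReal.ofReal (-d) =
      ENNReal.ofReal a + 2 * ENNReal.ofReal d := by
  rw [← ENNReal.ofReal_add hb hc, h]
  rcases le_total 0 d with hd | hd
  · rw [ENNReal.ofReal_of_nonpos (neg_nonpos.2 hd), ENNReal.ofReal_add ha (by positivity),
      ENNReal.ofReal_mul zero_le_two]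
    simp
  · rw [ENNReal.ofReal_of_nonpos hd, mul_zero, add_zero, ← ENNReal.ofReal_ofNat 2,
      ← ENNReal.ofReal_mul zero_le_two, ← ENNReal.ofReal_add (by linarith) (by linarith)]
    congr 1
    ring

/-- With `m` the mean of `f`, expanding the square produces `-2 Re(conj m · c)`, which is rewritten
as `-2‖c‖² + 2 Re(conj (c - m) · c)`. -/
theorem lintegral_enorm_sub_sq_add {α : Type*} [MeasurableSpace α] {ν : Measure α}
    [IsProbabilityMeasure ν] {f : α → ℂ} (hf : MemLp f 2 ν) (c : ℂ) :
    ∫⁻ h, ‖f h - c‖ₑ ^ 2 ∂ν + ‖c‖ₑ ^ 2 +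
        2 * ENNReal.ofReal (-(conj (c - ∫ h, f h ∂ν) * c).re) =
      ∫⁻ h, ‖f h‖ₑ ^ 2 ∂ν + 2 * ENNReal.ofReal (conj (c - ∫ h, f h ∂ν) * c).re := by
  have hlin : ∀ g : α → ℂ, MemLp g 2 ν →
      ∫⁻ h, ‖g h‖ₑ ^ 2 ∂ν = ENNReal.ofReal (∫ h, ‖g h‖ ^ 2 ∂ν) := by
    intro g hg
    rw [ofReal_integral_eq_lintegral_ofReal hg.integrable_norm_pow' (by
      exact Eventually.of_forall fun _ ↦ by positivity)]
    refine lintegral_congr fun h ↦ ?_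
    rw [ENNReal.ofReal_pow (norm_nonneg _), ofReal_norm]
  have hfi : Integrable f ν := hf.integrable one_le_two
  have hfc : MemLp (fun h ↦ f h - c) 2 ν := hf.sub (memLp_const c)
  have hsq : Integrable (fun h ↦ ‖f h‖ ^ 2) ν := hf.integrable_norm_pow'
  have hcf : Integrable (fun h ↦ conj (f h) * c) ν :=
    (LinearIsometryEquiv.integrable_comp_iff conjLIE |>.2 hfi).mul_const c
  have hre : ∫ h, (conj (f h) * c).re ∂ν = (conj (∫ h, f h ∂ν) * c).re := by
    rw [← integral_conj, ← integral_mul_const]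
    exact reCLM.integral_comp_comm hcf
  have hkey : ∫ h, ‖f h - c‖ ^ 2 ∂ν + ‖c‖ ^ 2 =
      ∫ h, ‖f h‖ ^ 2 ∂ν + 2 * (conj (c - ∫ h, f h ∂ν) * c).re := by
    have e1 : ∀ h, ‖f h - c‖ ^ 2 = ‖f h‖ ^ 2 + ‖c‖ ^ 2 - 2 * (conj (f h) * c).re := by
      intro h
      rw [← normSq_eq_norm_sq, ← normSq_eq_norm_sq, ← normSq_eq_norm_sq, normSq_sub,
        ← conj_re (f h * conj c), map_mul, conj_conj]
    have e2 : (conj (c - ∫ h, f h ∂ν) * c).re = ‖c‖ ^ 2 - (conj (∫ h, f h ∂ν) * c).re := by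
      rw [map_sub, sub_mul, sub_re, ← normSq_eq_conj_mul_self, ofReal_re, normSq_eq_norm_sq]
    have hre' : Integrable (fun h ↦ 2 * (conj (f h) * c).re) ν := hcf.re.const_mul 2
    have hsq' : Integrable (fun h ↦ ‖f h‖ ^ 2 + ‖c‖ ^ 2) ν := hsq.add (integrable_const _)
    simp_rw [e1]
    rw [integral_sub hsq' hre', integral_add hsq (integrable_const _),
      integral_const_mul, hre, e2]
    simp
    ring
  rw [hlin _ hf, hlin _ hfc, ← ofReal_norm, ← ENNReal.ofReal_pow (norm_nonneg _)]
  exact ofReal_add_ofReal_neg_eq (integral_nonneg fun _ ↦ by positivity)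
    (integral_nonneg fun _ ↦ by positivity) (by positivity) hkey

/-! ### Tent cutoff and almost translation invariance -/

/-- The radial cutoff that decreases linearly from `1` at the origin to `0` at distance `n`. -/
noncomputable def tent (n : ℕ) (x : ℂ) : ℝ≥0∞ := ENNReal.ofReal (1 - ‖x‖ / n)

theorem measurable_tent (n : ℕ) : Measurable (tent n) := by
  unfold tent
  fun_prop

theorem tent_le_one (n : ℕ) (x : ℂ) : tent n x ≤ 1 := by
  refine ENNReal.ofReal_le_one.2 ?_
  linarith [show 0 ≤ ‖x‖ / n by positivity]

theorem tent_le_indicator {n : ℕ} (hn : 0 < n) (x : ℂ) :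
    tent n x ≤ (ball (0 : ℂ) n).indicator 1 x := by
  by_cases h : x ∈ ball (0 : ℂ) n
  · rw [indicator_of_mem h]
    exact tent_le_one n x
  · rw [mem_ball_zero_iff, not_lt] at h
    rw [tent, ENNReal.ofReal_of_nonpos]
    · exact zero_le
    · rw [sub_nonpos, one_le_div (by positivity)]
      exact h

theorem tendsto_tent (x : ℂ) : Tendsto (fun n ↦ tent n x) atTop (𝓝 1) := by
  simpa [tent] using
    ENNReal.tendsto_ofReal ((tendsto_const_div_atTop_nhds_zero_nat ‖x‖).const_sub 1)

/-- The tent has Lipschitz constant `1/n`, and its translate vanishes off the ball of radius `n +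
r`. -/
theorem tent_sub_le {n : ℕ} (hn : 0 < n) {r : ℝ} {h : ℂ} (hh : ‖h‖ < r) (x : ℂ) :
    tent n (x - h) ≤
      tent n x + ENNReal.ofReal (r / n) * (ball (0 : ℂ) (n + r)).indicator 1 x := by
  have hn' : (0 : ℝ) < n := by exact_mod_cast hn
  have hr : 0 < r := (norm_nonneg h).trans_lt hh
  have hx : ‖x‖ ≤ ‖x - h‖ + ‖h‖ := norm_le_norm_sub_add x h
  by_cases hxn : x ∈ ball (0 : ℂ) (n + r)
  · rw [indicator_of_mem hxn, Pi.one_apply, mul_one, tent, tent]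
    refine (ENNReal.ofReal_le_ofReal ?_).trans ENNReal.ofReal_add_le
    have : (‖x‖ - r) / n ≤ ‖x - h‖ / n := by
      gcongr
      linarith
    rw [sub_div] at this
    linarith
  · rw [mem_ball_zero_iff, not_lt] at hxn
    have hz : tent n (x - h) = 0 := by
      rw [tent, ENNReal.ofReal_of_nonpos]
      rw [sub_nonpos, one_le_div hn']
      linarith
    rw [hz]
    exact zero_le

/-- Translation invariance moves the shift from `f` to the tent, where it costs only `r/n` on a
slightly larger ball. -/
theorem lintegral_tent_mul_average_le {r : ℝ} (hr : 0 < r) {n : ℕ} (hn : 0 < n) {f : ℂ → ℝ≥0∞}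
    (hf : Measurable f) :
    ∫⁻ x, tent n x * ∫⁻ h, f (x + h) ∂(ballMeasure r) ≤
      (∫⁻ x, tent n x * f x) + ENNReal.ofReal (r / n) * ∫⁻ x in ball (0 : ℂ) (n + r), f x := by
  have := isProbabilityMeasure_ballMeasure hr
  have ht := measurable_tent n
  have hm : Measurable fun p : ℂ × ℂ ↦ tent n p.1 * f (p.1 + p.2) := by fun_prop
  have hi : Measurable fun x ↦ (ball (0 : ℂ) (n + r)).indicator 1 x * f x :=
    (measurable_one.indicator measurableSet_ball).mul hf
  calc ∫⁻ x, tent n x * ∫⁻ h, f (x + h) ∂(ballMeasure r)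
      = ∫⁻ x, ∫⁻ h, tent n x * f (x + h) ∂(ballMeasure r) :=
        lintegral_congr fun x ↦ (lintegral_const_mul _ (by fun_prop)).symm
    _ = ∫⁻ h, ∫⁻ x, tent n x * f (x + h) ∂volume ∂(ballMeasure r) :=
        lintegral_lintegral_swap hm.aemeasurable
    _ ≤ ∫⁻ _, ((∫⁻ x, tent n x * f x) +
          ENNReal.ofReal (r / n) * ∫⁻ x in ball (0 : ℂ) (n + r), f x) ∂(ballMeasure r) := by
        refine lintegral_mono_ae ?_
        filter_upwards [ae_ballMeasure_mem r] with h hh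
        rw [mem_ball_zero_iff] at hh
        rw [← lintegral_sub_right_eq_self _ h]
        simp only [sub_add_cancel]
        calc ∫⁻ x, tent n (x - h) * f x
            ≤ ∫⁻ x, (tent n x * f x + ENNReal.ofReal (r / n) *
                ((ball (0 : ℂ) (n + r)).indicator 1 x * f x)) := by
              refine lintegral_mono fun x ↦ ?_
              rw [← mul_assoc, ← add_mul]
              exact mul_le_mul_left (tent_sub_le hn hh x) _
          _ = _ := by
              rw [lintegral_add_left (by fun_prop), lintegral_const_mul _ hi,
                ← lintegral_indicator measurableSet_ball]
              simp only [← indicator_mul_left, Pi.one_apply, one_mul]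
    _ = _ := by simp

theorem lintegral_tent_mul_ne_top {n : ℕ} (hn : 0 < n) {f : ℂ → ℝ≥0∞}
    (hf : ∫⁻ x in ball (0 : ℂ) n, f x ≠ ∞) : ∫⁻ x, tent n x * f x ≠ ∞ := by
  refine ne_top_of_le_ne_top hf ?_
  rw [← lintegral_indicator measurableSet_ball]
  refine lintegral_mono fun x ↦ ?_
  refine (mul_le_mul_left (tent_le_indicator hn x) _).trans ?_
  rw [← indicator_mul_left]
  simp

/-! ### The cross term -/

theorem conj_defectPotential_mul_eq_integral {r : ℝ} {μ : Measure ℂ} [IsFiniteMeasure μ]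
    {w : ℂ → ℂ} (x : ℂ) :
    conj (defectPotential r μ w x) * cauchyPotential μ w x =
      ∫ p : ℂ × ℂ, conj (w p.2 * cauchyDefect r (x - p.2)) * (w p.1 * (x - p.1)⁻¹) ∂(μ.prod μ) := by
  rw [defectPotential, ← integral_conj, cauchyPotential, mul_comm, ← integral_prod_mul]
  congr with p
  ring

theorem integrable_defect_kernel {r : ℝ} (hr : 0 < r) {μ : Measure ℂ} [IsFiniteMeasure μ]
    (hE : logEnergy r μ ≠ ∞) {w : ℂ → ℂ} (hw : Measurable w) (hw1 : ∀ y, ‖w y‖ₑ ≤ 1) :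
    Integrable (fun q : ℂ × ℂ × ℂ ↦
      conj (w q.2.2 * cauchyDefect r (q.1 - q.2.2)) * (w q.2.1 * (q.1 - q.2.1)⁻¹))
      (volume.prod (μ.prod μ)) := by
  have hq := measurable_cauchyDefect r
  have hc : Measurable (starRingEnd ℂ) := continuous_conj.measurable
  have hm : Measurable fun q : ℂ × ℂ × ℂ ↦
      conj (w q.2.2 * cauchyDefect r (q.1 - q.2.2)) * (w q.2.1 * (q.1 - q.2.1)⁻¹) := by fun_prop
  refine ⟨hm.aestronglyMeasurable, ?_⟩
  rw [HasFiniteIntegral, lintegral_prod_symm' _ hm.enorm]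
  have hL : Measurable fun p : ℂ × ℂ ↦ logKernel r (p.1 - p.2) :=
    (measurable_logKernel r).comp (by fun_prop)
  calc ∫⁻ p : ℂ × ℂ, ∫⁻ x, ‖conj (w p.2 * cauchyDefect r (x - p.2)) * (w p.1 * (x - p.1)⁻¹)‖ₑ
        ∂volume ∂(μ.prod μ)
      ≤ ∫⁻ p : ℂ × ℂ, (ENNReal.ofReal (12 * π) +
          ENNReal.ofReal (8 * π) * logKernel r (p.1 - p.2)) ∂(μ.prod μ) := by
        refine lintegral_mono fun p ↦ ?_
        refine le_trans (lintegral_mono fun x ↦ ?_) (lintegral_cauchyDefect_mul_le hr p.1 p.2)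
        rw [enorm_mul, RCLike.enorm_conj, enorm_mul, enorm_mul]
        exact mul_le_mul' (mul_le_of_le_one_left' (hw1 _)) (mul_le_of_le_one_left' (hw1 _))
    _ < ∞ := by
        rw [lintegral_add_left measurable_const, lintegral_const, lintegral_const_mul _ hL]
        rw [← logEnergy]
        exact lt_top_iff_ne_top.2 (by finiteness)

theorem integrable_conj_defectPotential_mul {r : ℝ} (hr : 0 < r) {μ : Measure ℂ}
    [IsFiniteMeasure μ] (hE : logEnergy r μ ≠ ∞) {w : ℂ → ℂ} (hw : Measurable w)
    (hw1 : ∀ y, ‖w y‖ₑ ≤ 1) :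
    Integrable fun x ↦ conj (defectPotential r μ w x) * cauchyPotential μ w x := by
  simp_rw [conj_defectPotential_mul_eq_integral]
  exact (integrable_defect_kernel hr hE hw hw1).integral_prod_left

/-- After Fubini, translating by `p.2` turns the inner integral into the single-kernel integral at
`p.1 - p.2`; the weights have modulus at most one. -/
theorem enorm_integral_conj_defectPotential_mul_le {r : ℝ} (hr : 0 < r) {μ : Measure ℂ}
    [IsFiniteMeasure μ] (hE : logEnergy r μ ≠ ∞) {w : ℂ → ℂ} (hw : Measurable w)
    (hw1 : ∀ y, ‖w y‖ₑ ≤ 1) :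
    ‖∫ x, conj (defectPotential r μ w x) * cauchyPotential μ w x‖ₑ ≤
      ENNReal.ofReal (2 * π) * logEnergy r μ := by
  have hL : Measurable fun p : ℂ × ℂ ↦ logKernel r (p.1 - p.2) :=
    (measurable_logKernel r).comp (by fun_prop)
  simp_rw [conj_defectPotential_mul_eq_integral]
  rw [integral_integral_swap (integrable_defect_kernel hr hE hw hw1), logEnergy,
    ← lintegral_const_mul _ hL]
  refine (enorm_integral_le_lintegral_enorm _).trans (lintegral_mono fun p ↦ ?_)
  have h1 : ∫ x, conj (w p.2 * cauchyDefect r (x - p.2)) * (w p.1 * (x - p.1)⁻¹) =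
      (conj (w p.2) * w p.1) * ∫ x, conj (cauchyDefect r x) * (x - (p.1 - p.2))⁻¹ := by
    rw [← integral_const_mul, ← integral_add_right_eq_self _ p.2]
    congr with x
    rw [add_sub_cancel_right, map_mul, sub_sub_eq_add_sub]
    ring
  rw [h1, enorm_mul, enorm_mul, RCLike.enorm_conj]
  exact (mul_le_of_le_one_left' (mul_le_one' (hw1 _) (hw1 _))).trans
    (enorm_integral_conj_cauchyDefect_mul_le hr _)

/-! ### The increment estimate -/

theorem ae_lintegral_enorm_cauchyPotential_sub_sq_add {r : ℝ} (hr : 0 < r) {μ : Measure ℂ}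
    [IsFiniteMeasure μ] (hE : logEnergy r μ ≠ ∞) {w : ℂ → ℂ} (hw : Measurable w)
    (hw1 : ∀ y, ‖w y‖ₑ ≤ 1) :
    ∀ᵐ x, ∫⁻ h, ‖cauchyPotential μ w (x + h) - cauchyPotential μ w x‖ₑ ^ 2 ∂(ballMeasure r) +
        ‖cauchyPotential μ w x‖ₑ ^ 2 +
        2 * ENNReal.ofReal (-(conj (defectPotential r μ w x) * cauchyPotential μ w x).re) =
      ∫⁻ h, ‖cauchyPotential μ w (x + h)‖ₑ ^ 2 ∂(ballMeasure r) +
        2 * ENNReal.ofReal (conj (defectPotential r μ w x) * cauchyPotential μ w x).re := by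
  have := isProbabilityMeasure_ballMeasure hr
  have hv := measurable_cauchyPotential μ hw
  have hV := measurable_absPotential μ
  filter_upwards [ae_absPotential_lt_top μ hr hE,
    ae_lintegral_ballMeasure_absPotential_sq_lt_top μ hr hE] with x hx hxr
  have hxr1 : ∫⁻ h, absPotential μ (x + h) ∂(ballMeasure r) < ∞ := by
    refine lt_of_le_of_lt (lintegral_mono (g := fun h ↦ 1 + absPotential μ (x + h) ^ 2)
      fun h ↦ ?_) (?_ : _ < ∞)
    · rcases le_total (absPotential μ (x + h)) 1 with h1 | h1
      · exact h1.trans le_self_add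
      · exact (le_self_pow₀ h1 two_ne_zero).trans le_add_self
    · rw [lintegral_add_left measurable_const]
      simpa using hxr
  have hmem : MemLp (fun h ↦ cauchyPotential μ w (x + h)) 2 (ballMeasure r) := by
    refine ⟨(by fun_prop : Measurable _).aestronglyMeasurable, ?_⟩
    rw [eLpNorm_lt_top_iff_lintegral_rpow_enorm_lt_top two_ne_zero ENNReal.ofNat_ne_top]
    refine lt_of_le_of_lt (lintegral_mono fun h ↦ ?_) hxr
    simp only [ENNReal.toReal_ofNat, ENNReal.rpow_ofNat]
    gcongr
    exact enorm_cauchyPotential_le μ hw1 _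
  have key := lintegral_enorm_sub_sq_add hmem (cauchyPotential μ w x)
  rwa [integral_ballMeasure_cauchyPotential hw hw1 hr hx hxr1, sub_sub_cancel] at key

/-- The averaged squared increments of a Cauchy potential are controlled by the logarithmic
energy of the measure at the same scale. -/
theorem lintegral_lintegral_cauchyPotential_sub_sq_le {r : ℝ} (hr : 0 < r) {μ : Measure ℂ}
    [IsFiniteMeasure μ] {w : ℂ → ℂ} (hw : Measurable w) (hw1 : ∀ y, ‖w y‖ₑ ≤ 1) :
    ∫⁻ h, ∫⁻ x, ‖cauchyPotential μ w (x + h) - cauchyPotential μ w x‖ₑ ^ 2 ∂volume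
      ∂(ballMeasure r) ≤ ENNReal.ofReal (4 * π) * logEnergy r μ := by
  rcases eq_or_ne (logEnergy r μ) ∞ with hE | hE
  · rw [hE, ENNReal.mul_top (by simp [pi_pos])]
    exact le_top
  have := isProbabilityMeasure_ballMeasure hr
  have hv := measurable_cauchyPotential μ hw
  have hQ := measurable_defectPotential r μ hw
  have hc : Measurable (starRingEnd ℂ) := continuous_conj.measurable
  set v := cauchyPotential μ w with hv_def
  set b : ℂ → ℝ := fun x ↦ (conj (defectPotential r μ w x) * v x).re with hb_def
  have hbm : Measurable b := by fun_prop
  have hbint : Integrable b := (integrable_conj_defectPotential_mul hr hE hw hw1).re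
  have hmφ : Measurable fun p : ℂ × ℂ ↦ ‖v (p.1 + p.2) - v p.1‖ₑ ^ 2 := by fun_prop
  set φ : ℂ → ℝ≥0∞ := fun x ↦ ∫⁻ h, ‖v (x + h) - v x‖ₑ ^ 2 ∂(ballMeasure r) with hφ_def
  have hφm : Measurable φ := hmφ.lintegral_prod_right'
  have hswap : ∫⁻ h, ∫⁻ x, ‖v (x + h) - v x‖ₑ ^ 2 ∂volume ∂(ballMeasure r) = ∫⁻ x, φ x :=
    (lintegral_lintegral_swap hmφ.aemeasurable).symm
  have hbp : ∫⁻ x, ENNReal.ofReal (b x) ≠ ∞ := hbint.lintegral_lt_top.ne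
  have hbn : ∫⁻ x, ENNReal.ofReal (-b x) ≠ ∞ := hbint.neg.lintegral_lt_top.ne
  have hvV : ∀ x, ‖v x‖ₑ ^ 2 ≤ absPotential μ x ^ 2 := fun x ↦ by
    gcongr
    exact enorm_cauchyPotential_le μ hw1 x
  have hav : ∀ ρ : ℝ, ∫⁻ x in ball (0 : ℂ) ρ, ‖v x‖ₑ ^ 2 ≠ ∞ := fun ρ ↦
    ne_top_of_le_ne_top (lintegral_ball_absPotential_sq_ne_top μ hr hE ρ)
      (lintegral_mono fun x ↦ hvV x)
  -- This is the integrated identity after `A|v|²` and `|v|²` cancel; it is proved with the tent as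
  -- weight and then `n → ∞`.
  have hmain : ∫⁻ x, (φ x + 2 * ENNReal.ofReal (-b x)) ≤ 2 * ∫⁻ x, ENNReal.ofReal (b x) := by
    have hn : ∀ n : ℕ, 0 < n → ∫⁻ x, tent n x * (φ x + 2 * ENNReal.ofReal (-b x)) ≤
        (ENNReal.ofReal (r / n) * ∫⁻ x in ball (0 : ℂ) (n + r), absPotential μ x ^ 2) +
          2 * ∫⁻ x, ENNReal.ofReal (b x) := by
      intro n hn
      have ht := measurable_tent n
      have hfin : ∫⁻ x, tent n x * ‖v x‖ₑ ^ 2 ≠ ∞ := lintegral_tent_mul_ne_top hn (hav n)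
      have ham : Measurable fun x ↦ ∫⁻ h, ‖v (x + h)‖ₑ ^ 2 ∂(ballMeasure r) :=
        Measurable.lintegral_prod_right' (f := fun p : ℂ × ℂ ↦ ‖v (p.1 + p.2)‖ₑ ^ 2) (by fun_prop)
      -- The tent-weighted integral of `|v|²` is finite, so it may be added to both sides and
      -- cancelled.
      refine ENNReal.le_of_add_le_add_right hfin ?_
      calc (∫⁻ x, tent n x * (φ x + 2 * ENNReal.ofReal (-b x))) + ∫⁻ x, tent n x * ‖v x‖ₑ ^ 2
          = ∫⁻ x, tent n x * (φ x + ‖v x‖ₑ ^ 2 + 2 * ENNReal.ofReal (-b x)) := by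
            rw [← lintegral_add_right _ (by fun_prop)]
            refine lintegral_congr fun x ↦ ?_
            ring
        _ = ∫⁻ x, tent n x * (∫⁻ h, ‖v (x + h)‖ₑ ^ 2 ∂(ballMeasure r) +
              2 * ENNReal.ofReal (b x)) := by
            refine lintegral_congr_ae ?_
            filter_upwards [ae_lintegral_enorm_cauchyPotential_sub_sq_add hr hE hw hw1] with x hx
            exact congrArg _ hx
        _ ≤ ∫⁻ x, (tent n x * ∫⁻ h, ‖v (x + h)‖ₑ ^ 2 ∂(ballMeasure r) +
              2 * ENNReal.ofReal (b x)) := by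
            refine lintegral_mono fun x ↦ ?_
            rw [mul_add]
            exact add_le_add le_rfl (mul_le_of_le_one_left' (tent_le_one n x))
        _ = (∫⁻ x, tent n x * ∫⁻ h, ‖v (x + h)‖ₑ ^ 2 ∂(ballMeasure r)) +
              2 * ∫⁻ x, ENNReal.ofReal (b x) := by
            rw [lintegral_add_left (by fun_prop), lintegral_const_mul _ (by fun_prop)]
        _ ≤ ((∫⁻ x, tent n x * ‖v x‖ₑ ^ 2) + ENNReal.ofReal (r / n) *
              ∫⁻ x in ball (0 : ℂ) (n + r), absPotential μ x ^ 2) +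
              2 * ∫⁻ x, ENNReal.ofReal (b x) := by
            gcongr
            refine (lintegral_tent_mul_average_le hr hn (hv.enorm.pow_const 2)).trans ?_
            gcongr with x
            exact enorm_cauchyPotential_le μ hw1 x
        _ = _ := by rw [add_assoc, add_comm]
    have hlim : ∀ x, Tendsto (fun n ↦ tent n x * (φ x + 2 * ENNReal.ofReal (-b x))) atTop
        (𝓝 (φ x + 2 * ENNReal.ofReal (-b x))) := fun x ↦ by
      simpa using ENNReal.Tendsto.mul_const (tendsto_tent x) (Or.inl one_ne_zero)
    have hδ := (tendsto_div_mul_lintegral_ball_absPotential_sq μ hr hE).add_const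
      (2 * ∫⁻ x, ENNReal.ofReal (b x))
    rw [zero_add] at hδ
    -- Fatou's lemma removes the cutoff while the error term tends to zero.
    calc ∫⁻ x, (φ x + 2 * ENNReal.ofReal (-b x))
        = ∫⁻ x, liminf (fun n ↦ tent n x * (φ x + 2 * ENNReal.ofReal (-b x))) atTop :=
          lintegral_congr fun x ↦ (hlim x).liminf_eq.symm
      _ ≤ liminf (fun n ↦ ∫⁻ x, tent n x * (φ x + 2 * ENNReal.ofReal (-b x))) atTop :=
          lintegral_liminf_le fun n ↦ (measurable_tent n).mul (by fun_prop)
      _ ≤ liminf (fun n : ℕ ↦ (ENNReal.ofReal (r / n) *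
            ∫⁻ x in ball (0 : ℂ) (n + r), absPotential μ x ^ 2) +
              2 * ∫⁻ x, ENNReal.ofReal (b x)) atTop :=
          liminf_le_liminf ((eventually_gt_atTop 0).mono hn)
      _ = _ := hδ.liminf_eq
  rw [lintegral_add_left hφm, lintegral_const_mul _ (by fun_prop)] at hmain
  rw [hswap]
  have hb_eq : ∫ x, b x =
      (∫⁻ x, ENNReal.ofReal (b x)).toReal - (∫⁻ x, ENNReal.ofReal (-b x)).toReal :=
    integral_eq_lintegral_pos_part_sub_lintegral_neg_part hbint
  have hb_le : ∫⁻ x, ENNReal.ofReal (b x) ≤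
      ENNReal.ofReal (∫ x, b x) + ∫⁻ x, ENNReal.ofReal (-b x) := by
    rw [← ENNReal.ofReal_toReal hbp, ← ENNReal.ofReal_toReal hbn]
    refine (ENNReal.ofReal_le_ofReal ?_).trans ENNReal.ofReal_add_le
    rw [hb_eq]
    linarith
  have hΦ : ∫⁻ x, φ x ≤ 2 * ENNReal.ofReal (∫ x, b x) := by
    have hfin : 2 * ∫⁻ x, ENNReal.ofReal (-b x) ≠ ∞ := by finiteness
    refine ENNReal.le_of_add_le_add_right hfin ?_
    rw [← mul_add]
    exact hmain.trans (by gcongr)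
  refine hΦ.trans ?_
  have hre : ∫ x, b x = (∫ x, conj (defectPotential r μ w x) * v x).re :=
    reCLM.integral_comp_comm (integrable_conj_defectPotential_mul hr hE hw hw1)
  have h1 : ENNReal.ofReal (∫ x, b x) ≤ ENNReal.ofReal (2 * π) * logEnergy r μ := by
    refine le_trans ?_ (enorm_integral_conj_defectPotential_mul_le hr hE hw hw1)
    rw [hre, ← ofReal_norm]
    exact ENNReal.ofReal_le_ofReal (re_le_norm _)
  grw [h1]
  rw [← mul_assoc, show 4 * π = 2 * (2 * π) by ring, ENNReal.ofReal_mul (q := 2 * π) zero_le_two,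
    ENNReal.ofReal_ofNat]

/-! ### Energy bounds from the decay of mass on small balls -/

/-- For fixed `x` and `s`, integrating the condition `‖x - y‖ ≤ s` in `y` gives the mass of a closed
ball; Tonelli leaves the weight `ds/s`. -/
theorem logEnergy_le_of_measure_closedBall_le {μ : Measure ℂ} [IsFiniteMeasure μ] {r : ℝ}
    {m : ℝ → ℝ≥0∞} (h : ∀ s ∈ Ioo 0 r, ∀ x, μ (closedBall x s) ≤ m s) :
    logEnergy r μ ≤ (∫⁻ s in Ioo 0 r, ENNReal.ofReal s⁻¹ * m s) * μ univ := by
  have hm : Measurable fun q : (ℂ × ℂ) × ℝ ↦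
      if ‖q.1.1 - q.1.2‖ ≤ q.2 then ENNReal.ofReal q.2⁻¹ else 0 :=
    measurable_logKernel_integrand.comp (g := fun p : ℂ × ℝ ↦ _)
      (f := fun q : (ℂ × ℂ) × ℝ ↦ (q.1.1 - q.1.2, q.2)) (by fun_prop)
  have hL : Measurable fun p : ℂ × ℂ ↦ logKernel r (p.1 - p.2) :=
    (measurable_logKernel r).comp (by fun_prop)
  rw [logEnergy, lintegral_prod _ hL.aemeasurable, ← lintegral_const]
  refine lintegral_mono fun x ↦ ?_
  have hm' : Measurable fun q : ℂ × ℝ ↦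
      if ‖x - q.1‖ ≤ q.2 then ENNReal.ofReal q.2⁻¹ else 0 :=
    hm.comp (g := fun p : (ℂ × ℂ) × ℝ ↦ _) (f := fun q : ℂ × ℝ ↦ ((x, q.1), q.2)) (by fun_prop)
  simp only [logKernel]
  rw [lintegral_lintegral_swap hm'.aemeasurable]
  refine setLIntegral_mono' measurableSet_Ioo fun s hs ↦ ?_
  have h1 : ∀ y : ℂ, (if ‖x - y‖ ≤ s then ENNReal.ofReal s⁻¹ else 0) =
      (closedBall x s).indicator (fun _ ↦ ENNReal.ofReal s⁻¹) y := fun y ↦ by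
    simp [indicator, dist_eq_norm, norm_sub_rev]
  simp_rw [h1]
  rw [lintegral_indicator_const measurableSet_closedBall]
  gcongr
  exact h s hs x

/-- At the endpoint `0` the conventions `log 0 = 0` and `0 ^ (1 - β) = 0` agree with the limit,
because `1 - β < 0`. -/
theorem continuousOn_neg_log_rpow {β r : ℝ} (hβ : 1 < β) (hr : r < 1) :
    ContinuousOn (fun s ↦ (-Real.log s) ^ (1 - β)) (Icc 0 r) := by
  intro s hs
  rcases hs.1.eq_or_lt with rfl | hs0
  · refine ContinuousWithinAt.mono (t := Ici 0) ?_ fun s hs ↦ hs.1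
    rw [← continuousWithinAt_Ioi_iff_Ici, ContinuousWithinAt, Real.log_zero, neg_zero,
      Real.zero_rpow (by linarith)]
    have h := (tendsto_rpow_neg_atTop (show 0 < β - 1 by linarith)).comp
      (tendsto_neg_atBot_atTop.comp Real.tendsto_log_nhdsGT_zero)
    simpa [Function.comp_def] using h
  · have hlog : -Real.log s ≠ 0 := by
      have := Real.log_neg hs0 (hs.2.trans_lt hr)
      linarith
    exact ((Real.continuousAt_log hs0.ne').neg.rpow_const (Or.inl hlog)).continuousWithinAt

/-- An antiderivative is `C/(β-1) · (-log s)^(1-β)`, which vanishes at `0`. Integrability near `0`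
follows from nonnegativity of the derivative. -/
theorem lintegral_inv_mul_abs_log_rpow {β r : ℝ} (hβ : 1 < β) (hr : r < 1) (hr0 : 0 < r) {C : ℝ}
    (hC : 0 ≤ C) :
    ∫⁻ s in Ioo 0 r, ENNReal.ofReal s⁻¹ * ENNReal.ofReal (C * |Real.log s| ^ (-β)) =
      ENNReal.ofReal (C / (β - 1) * |Real.log r| ^ (1 - β)) := by
  have hβ1 : β - 1 ≠ 0 := by linarith
  set F : ℝ → ℝ := fun s ↦ C / (β - 1) * (-Real.log s) ^ (1 - β) with hF
  have hFc : ContinuousOn F (Icc 0 r) := continuousOn_const.mul (continuousOn_neg_log_rpow hβ hr)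
  have hderiv : ∀ s ∈ Ioo 0 r, HasDerivAt F (s⁻¹ * (C * |Real.log s| ^ (-β))) s := by
    intro s hs
    have hlog : 0 < -Real.log s := neg_pos.2 (Real.log_neg hs.1 (hs.2.trans hr))
    have h := (((Real.hasDerivAt_log hs.1.ne').neg).rpow_const (p := 1 - β)
      (Or.inl hlog.ne')).const_mul (C / (β - 1))
    refine h.congr_deriv ?_
    rw [abs_of_neg (neg_pos.1 hlog), show 1 - β - 1 = -β by ring, Pi.neg_apply]
    field_simp
    ring
  have hnn : ∀ s ∈ Ioo 0 r, 0 ≤ s⁻¹ * (C * |Real.log s| ^ (-β)) := fun s hs ↦ by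
    have := hs.1
    positivity
  have hint := intervalIntegral.integrableOn_deriv_of_nonneg hFc hderiv hnn
  have hval := intervalIntegral.integral_eq_sub_of_hasDerivAt_of_le hr0.le hFc hderiv
    ((intervalIntegrable_iff_integrableOn_Ioc_of_le hr0.le).2 hint)
  rw [intervalIntegral.integral_of_le hr0.le, integral_Ioc_eq_integral_Ioo] at hval
  have h0 : F 0 = 0 := by simp [hF, Real.zero_rpow (show 1 - β ≠ 0 by linarith)]
  have hlogr : Real.log r < 0 := Real.log_neg hr0 hr
  rw [h0, sub_zero] at hval
  rw [abs_of_neg hlogr, show C / (β - 1) * (-Real.log r) ^ (1 - β) = F r from rfl, ← hval,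
    ofReal_integral_eq_lintegral_ofReal (hint.mono_set Ioo_subset_Ioc_self)
      ((ae_restrict_mem measurableSet_Ioo).mono hnn)]
  refine setLIntegral_congr_fun measurableSet_Ioo fun s hs ↦ ?_
  exact (ENNReal.ofReal_mul (inv_nonneg.2 hs.1.le)).symm

/-! ### Transfer from signed measures on the plane to Cauchy potentials -/

/-- Polar decomposition of a signed measure: integrals against it are integrals against its total
variation with a measurable sign. -/
theorem exists_sign_integral_eq {X E : Type*} [MeasurableSpace X] [NormedAddCommGroup E]
    [NormedSpace ℝ E] (ω : SignedMeasure X) :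
    ∃ σ : X → ℝ, Measurable σ ∧ (∀ x, |σ x| = 1) ∧
      ∀ f : X → E, ∫ᵛ x, f x ∂<•ω = ∫ x, σ x • f x ∂ω.totalVariation := by
  classical
  obtain ⟨S, hS, -, -, hpos, hneg⟩ := ω.toJordanDecomposition.exists_compl_positive_negative
  set p := ω.toJordanDecomposition.posPart with hp
  set n := ω.toJordanDecomposition.negPart with hn
  have hω : ω = p.toSignedMeasure - n.toSignedMeasure :=
    ω.toSignedMeasure_toJordanDecomposition.symm
  have htv : ω.totalVariation = p + n := rfl
  have hσm : Measurable (S.piecewise (fun _ ↦ (-1 : ℝ)) fun _ ↦ 1) :=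
    measurable_const.piecewise hS measurable_const
  have hσ1 : ∀ x, |S.piecewise (fun _ ↦ (-1 : ℝ)) (fun _ ↦ 1) x| = 1 := by
    intro x
    by_cases hx : x ∈ S <;> simp [hx]
  refine ⟨_, hσm, hσ1, fun f ↦ ?_⟩
  -- Multiplying by a sign preserves integrability both ways, so for nonintegrable `f` both
  -- integrals take the default value `0`.
  have hiff : Integrable (fun x ↦ S.piecewise (fun _ ↦ (-1 : ℝ)) (fun _ ↦ 1) x • f x)
      ω.totalVariation ↔ Integrable f ω.totalVariation := by
    have hmul : ∀ g : X → E, Integrable g ω.totalVariation →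
        Integrable (fun x ↦ S.piecewise (fun _ ↦ (-1 : ℝ)) (fun _ ↦ 1) x • g x)
          ω.totalVariation := fun g hg ↦
      hg.mono (hσm.aestronglyMeasurable.smul hg.1) (Eventually.of_forall fun x ↦ by
        rw [norm_smul, Real.norm_eq_abs, hσ1, one_mul])
    refine ⟨fun h ↦ (hmul _ h).congr (Eventually.of_forall fun x ↦ ?_), hmul f⟩
    by_cases hx : x ∈ S <;> simp [hx]
  by_cases hf : Integrable f ω.totalVariation
  · have hfp : Integrable f p := (integrable_add_measure.1 (htv ▸ hf)).1
    have hfn : Integrable f n := (integrable_add_measure.1 (htv ▸ hf)).2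
    have hσf := hiff.2 hf
    rw [htv] at hσf
    obtain ⟨hσp, hσn⟩ := integrable_add_measure.1 hσf
    have e : ∫ᵛ x, f x ∂<•ω = ∫ᵛ x, f x ∂<•(p.toSignedMeasure - n.toSignedMeasure) := by
      rw [← hω]
    rw [e, VectorMeasure.integral_sub_vectorMeasure, VectorMeasure.integral_toSignedMeasure,
      VectorMeasure.integral_toSignedMeasure, htv, integral_add_measure hσp hσn]
    · have hp' : ∫ x, S.piecewise (fun _ ↦ (-1 : ℝ)) (fun _ ↦ 1) x • f x ∂p = ∫ x, f x ∂p := by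
        refine integral_congr_ae ?_
        filter_upwards [measure_eq_zero_iff_ae_notMem.1 hpos] with x hx
        simp [hx]
      have hn' : ∫ x, S.piecewise (fun _ ↦ (-1 : ℝ)) (fun _ ↦ 1) x • f x ∂n = - ∫ x, f x ∂n := by
        rw [← integral_neg]
        refine integral_congr_ae ?_
        filter_upwards [measure_eq_zero_iff_ae_notMem.1 hneg] with x hx
        simp [not_notMem.1 hx]
      rw [hp', hn', sub_eq_add_neg]
    · rwa [VectorMeasure.Integrable, Measure.variation_toSignedMeasure]
    · rwa [VectorMeasure.Integrable, Measure.variation_toSignedMeasure]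
  · rw [integral_undef (mt hiff.1 hf), VectorMeasure.integral_undef]
    rwa [VectorMeasure.Integrable, ← SignedMeasure.totalVariation_eq_variation]

/-- The standard identification of the plane with `ℂ`. -/
noncomputable def planeEquiv : Plane ≃ₗᵢ[ℝ] ℂ := Complex.orthonormalBasisOneI.repr.symm

theorem planeEquiv_apply (x : Plane) : planeEquiv x = x 0 + x 1 * I := by
  simp [planeEquiv, Complex.orthonormalBasisOneI, mul_comm]

/-- Rotation by a right angle is multiplication by `I`, and `x / |x|²` is the conjugate of `x⁻¹`. -/
theorem planeEquiv_biotSavartKernel (x : Plane) :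
    planeEquiv (biotSavartKernel x) = (I / (2 * π)) * conj ((planeEquiv x)⁻¹) := by
  have hn : ‖x‖ = ‖planeEquiv x‖ := (planeEquiv.norm_map x).symm
  rw [Complex.inv_def, map_mul, conj_conj, conj_ofReal, normSq_eq_norm_sq, ← hn, biotSavartKernel,
    map_smul, planeEquiv_apply, planeEquiv_apply, real_smul]
  have hI : I * I = -1 := I_mul_I
  push_cast
  simp
  linear_combination (-(x 1 : ℂ) / (2 * π * ‖x‖ ^ 2)) * hI

theorem exists_cauchyPotential_eq_biotSavart (ω : SignedMeasure Plane) :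
    ∃ w : ℂ → ℂ, Measurable w ∧ (∀ y, ‖w y‖ₑ ≤ 1) ∧ ∀ x,
      planeEquiv (biotSavart ω x) =
        (I / (2 * π)) * conj (cauchyPotential (ω.totalVariation.map planeEquiv) w (planeEquiv x)) := by
  obtain ⟨σ, hσ, hσ1, hσω⟩ := exists_sign_integral_eq (E := Plane) ω
  have hem : Measurable planeEquiv := planeEquiv.continuous.measurable
  have hem' : Measurable planeEquiv.symm := planeEquiv.symm.continuous.measurable
  have hm : ∀ x, Measurable fun y : ℂ ↦
      conj ((σ (planeEquiv.symm y) : ℂ) * (planeEquiv x - y)⁻¹) := fun x ↦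
    continuous_conj.measurable.comp (by fun_prop)
  refine ⟨fun y ↦ (σ (planeEquiv.symm y) : ℂ), by fun_prop, fun y ↦ ?_, fun x ↦ ?_⟩
  · rw [← ofReal_norm, norm_real, Real.norm_eq_abs, hσ1]
    simp
  · rw [biotSavart, hσω, cauchyPotential, ← integral_conj,
      integral_map hem.aemeasurable (hm x).aestronglyMeasurable, ← integral_const_mul,
      ← LinearIsometryEquiv.coe_toContinuousLinearEquiv,
      ← ContinuousLinearEquiv.integral_comp_comm]
    refine integral_congr_ae (Eventually.of_forall fun y ↦ ?_)
    simp only [LinearIsometryEquiv.coe_toContinuousLinearEquiv, map_smul,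
      LinearIsometryEquiv.symm_apply_apply, map_mul, conj_ofReal, real_smul,
      planeEquiv_biotSavartKernel, map_sub]
    ring

theorem structureFunctionSq_biotSavart_le (ω : SignedMeasure Plane) {r : ℝ} (hr : 0 < r) :
    structureFunctionSq (biotSavart ω) r ≤ logEnergy r (ω.totalVariation.map planeEquiv) := by
  obtain ⟨w, hw, hw1, hv⟩ := exists_cauchyPotential_eq_biotSavart ω
  set μ := ω.totalVariation.map planeEquiv with hμ
  set v := cauchyPotential μ w with hv_def
  have hmp : MeasurePreserving planeEquiv := planeEquiv.measurePreserving
  have hemb : MeasurableEmbedding planeEquiv := planeEquiv.toHomeomorph.measurableEmbedding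
  have hnorm : ∀ x h, ‖biotSavart ω (x + h) - biotSavart ω x‖ₑ ^ 2 =
      ENNReal.ofReal ((2 * π)⁻¹ ^ 2) *
        ‖v (planeEquiv x + planeEquiv h) - v (planeEquiv x)‖ₑ ^ 2 := by
    intro x h
    rw [← planeEquiv.enorm_map, map_sub, hv, hv, ← mul_sub, ← map_sub, enorm_mul,
      RCLike.enorm_conj, map_add, mul_pow, ENNReal.ofReal_pow (by positivity)]
    congr 2
    rw [← ofReal_norm]
    simp [abs_of_pos pi_pos]
  have hball : ball (0 : Plane) r = planeEquiv ⁻¹' ball (0 : ℂ) r := by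
    rw [LinearIsometryEquiv.preimage_ball, map_zero]
  have hvol : volume (ball (0 : Plane) r) = volume (ball (0 : ℂ) r) := by
    rw [hball, hmp.measure_preimage_emb hemb]
  have hvm : Measurable v := measurable_cauchyPotential μ hw
  have hm2 : Measurable fun p : ℂ × ℂ ↦ ‖v (p.2 + p.1) - v p.2‖ₑ ^ 2 := by fun_prop
  have hEq : structureFunctionSq (biotSavart ω) r = ENNReal.ofReal ((2 * π)⁻¹ ^ 2) *
      ∫⁻ h, ∫⁻ x, ‖v (x + h) - v x‖ₑ ^ 2 ∂volume ∂(ballMeasure r) := by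
    have h1 : ∀ h : Plane, ∫⁻ x, ‖biotSavart ω (x + h) - biotSavart ω x‖ₑ ^ 2 =
        ENNReal.ofReal ((2 * π)⁻¹ ^ 2) * ∫⁻ x, ‖v (x + planeEquiv h) - v x‖ₑ ^ 2 := by
      intro h
      simp_rw [hnorm]
      rw [lintegral_const_mul' _ _ ENNReal.ofReal_ne_top,
        hmp.lintegral_comp_emb hemb fun x ↦ ‖v (x + planeEquiv h) - v x‖ₑ ^ 2]
    rw [structureFunctionSq, laverage_eq']
    simp_rw [h1]
    rw [lintegral_const_mul' _ _ ENNReal.ofReal_ne_top, ballMeasure, lintegral_smul_measure,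
      lintegral_smul_measure, Measure.restrict_apply_univ, hvol, hball,
      hmp.setLIntegral_comp_preimage_emb hemb fun h ↦ ∫⁻ x, ‖v (x + h) - v x‖ₑ ^ 2]
  rw [hEq]
  have : IsFiniteMeasure μ := inferInstance
  grw [lintegral_lintegral_cauchyPotential_sub_sq_le hr hw hw1]
  rw [← mul_assoc, ← ENNReal.ofReal_mul (by positivity)]
  -- The factor `(2π)⁻²` of the kernel times the `4π` of the increment estimate is `1/π ≤ 1`.
  refine mul_le_of_le_one_left' (ENNReal.ofReal_le_one.2 ?_)
  have hpi := Real.pi_gt_three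
  rw [show (2 * π)⁻¹ ^ 2 * (4 * π) = π⁻¹ by field_simp; ring]
  exact inv_le_one_of_one_le₀ (by linarith)

theorem structureFunctionSq_congr_ae {u v : Plane → Plane} (h : u =ᵐ[volume] v) (r : ℝ) :
    structureFunctionSq u r = structureFunctionSq v r := by
  unfold structureFunctionSq
  congr with k
  refine lintegral_congr_ae ?_
  filter_upwards [h, (measurePreserving_add_right volume k).quasiMeasurePreserving.ae h]
    with x hx hxk
  rw [hx, hxk]

theorem totalVariation_closedBall_le (ω : SignedMeasure Plane) (x : Plane) (r : ℝ) :
    ω.totalVariation (closedBall x r) ≤ ENNReal.ofReal (vorticityMaximal ω r) := by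
  have hle : ∀ x, ω.totalVariation (closedBall x r) ≤ ω.totalVariation univ :=
    fun x ↦ measure_mono (subset_univ _)
  rw [vorticityMaximal, ENNReal.ofReal_toReal (ne_top_of_le_ne_top (measure_ne_top _ _)
    (iSup_le hle))]
  exact le_iSup (fun x ↦ ω.totalVariation (closedBall x r)) x

end VortexSheet

/-! ### Conclusion -/

theorem corollary2p1
    (ω : MeasureTheory.SignedMeasure VortexSheet.Plane)
    (hω : VortexSheet.MemHNegOneLoc ω)
    (u : VortexSheet.Plane → VortexSheet.Plane)
    (hu : u =ᵐ[MeasureTheory.volume] VortexSheet.biotSavart ω)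
    (C β R : ℝ) (hβ : 1 < β) (hR : R ≤ 1)
    (hM : ∀ r : ℝ, 0 < r → r < R →
      VortexSheet.vorticityMaximal ω r ≤ C * |Real.log r| ^ (-β)) :
    ∀ r : ℝ, 0 < r → r < R →
      VortexSheet.structureFunctionSq u r ≤
        ENNReal.ofReal (C / (β - 1) * VortexSheet.massNorm ω * |Real.log r| ^ (1 - β)) := by
  intro r hr hrR
  have hr1 : r < 1 := hrR.trans_le hR
  have hlog : 0 < |Real.log r| := abs_pos.2 (Real.log_neg hr hr1).ne
  -- The decay hypothesis at `r` bounds a nonnegative quantity by `C` times a positive number.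
  have hC : 0 ≤ C := by
    have h0 : 0 ≤ C * |Real.log r| ^ (-β) := ENNReal.toReal_nonneg.trans (hM r hr hrR)
    exact nonneg_of_mul_nonneg_left h0 (Real.rpow_pos_of_pos hlog _)
  have hem : Measurable VortexSheet.planeEquiv :=
    VortexSheet.planeEquiv.continuous.measurable
  rw [VortexSheet.structureFunctionSq_congr_ae hu]
  refine (VortexSheet.structureFunctionSq_biotSavart_le ω hr).trans ?_
  refine (VortexSheet.logEnergy_le_of_measure_closedBall_le
    (m := fun s ↦ ENNReal.ofReal (C * |Real.log s| ^ (-β))) fun s hs x ↦ ?_).trans ?_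
  · rw [Measure.map_apply hem measurableSet_closedBall,
      VortexSheet.planeEquiv.preimage_closedBall]
    exact (VortexSheet.totalVariation_closedBall_le ω _ s).trans
      (ENNReal.ofReal_le_ofReal (hM s hs.1 (hs.2.trans hrR)))
  · rw [VortexSheet.lintegral_inv_mul_abs_log_rpow hβ hr1 hr hC, Measure.map_apply hem .univ,
      preimage_univ, ← ENNReal.ofReal_toReal (measure_ne_top ω.totalVariation univ),
      ← ENNReal.ofReal_mul (by have := sub_pos.2 hβ; positivity)]
    refine ENNReal.ofReal_le_ofReal (le_of_eq ?_)
    rw [VortexSheet.massNorm]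
    ring
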